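/- Let $\alpha\in(0,1)$, $\beta>-1$ and $M>0$. Let $E$ be a complex Banach space and let $K:\mathbb{C}\setminus(-\infty,0]\to E$ be holomorphic with $\|K(z)\|\le M|z|^{-\alpha}$ for $|\arg z|<\pi$, and such that $K$ extends continuously, except possibly at $z=0$, from the open upper half plane to $\{\operatorname{Im}z\ge 0\}$ and from the open lower half plane to $\{\operatorname{Im}z\le 0\}$. Let $k:(0,\infty)\to E$ have $K$ as its Laplace transform, i.e. $K(z)=\int_0^\infty e^{-zt}k(t)\,dt$, absolutely convergent, on some half plane $\operatorname{Re}z>\sigma$. Put $$G(x)=\frac1{2\pi i}\bigl(K(e^{-i\pi}x)-K(e^{i\pi}x)\bigr),\quad x>0,$$ where $K(e^{\pm i\pi}x)$ are the boundary values of $K$ at $-x$ from above and from below the cut. Let $f(t)=t^\beta$ and $c(t)=\int_0^t k(t-s)f(s)\,ds$. For time points $0=t_0<t_1<\dots<t_n$ ($n\ge1$) with $\tau_j=t_j-t_{j-1}$, the generalized convolution quadrature (gCQ) approximation of $c(t_n)$ based on the implicit Euler method is $$c_n=\int_0^\infty G(x)\,y_n(x)\,dx,\qquad y_n(x)=\sum_{j=1}^n\tau_j\Bigl(\prod_{\ell=j}^n\frac1{1+\tau_\ell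 x}\Bigr)f(t_j).$$ (a) There is a constant $C>0$ depending only on $\alpha,\beta,M$ such that, for all such $E,K,k$ and arbitrary time points $0=t_0<t_1<\dots<t_n$, the integrals defining $c(t_n)$ and $c_n$ converge absolutely and there exist $\xi_j\in(t_{j-1},t_j)$, $2\le j\le n$, with $$\|c(t_n)-c_n\|\le C\Bigl(\tau_1^{\alpha+\beta}+\sum_{j=2}^n\tau_j^2\,\xi_j^{\alpha+\beta-2}\Bigr).$$ (b) For every $\gamma>0$ there is a constant $C>0$ depending only on $\alpha,\beta,\gamma,M$ such that, for all such $E,K,k$, all $T>0$ and all integers $1\le n\le N$, on the graded mesh $t_j=(j\tau)^\gamma$, $\tau=T^{1/\gamma}/N$, $$\|c(t_n)-c_n\|\le\begin{cases}C\,T^{\alpha+\beta}N^{-\gamma(\alpha+\beta)},&\gamma(\alpha+\beta)<1,\\ C\,T^{\alpha+\beta}N^{-1}(1+\log n),&\gamma(\alpha+\beta)=1,\\ C\,T^{1/\gamma}N^{-1}\,t_n^{\alpha+\beta-1/\gamma},&\gamma(\alpha+\beta)>1.\end{cases}$$ -/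

import Mathlib

open Set Filter Topology MeasureTheory

namespace GCQ

noncomputable section

variable {E : Type*} [NormedAddCommGroup E] [NormedSpace ℂ E]

/-- The sectorial assumption on `K`: it is holomorphic on the plane cut along `(-∞, 0]`, it is
bounded there by `M |z| ^ (-α)`, and it extends continuously, away from `0`, from the open upper
half plane to the closed one and from the open lower half plane to the closed one. The two
boundary values on the cut may differ. -/
structure IsSectorial (K : ℂ → E) (M α : ℝ) : Prop where
  differentiableOn : DifferentiableOn ℂ K Complex.slitPlane
  norm_le : ∀ z ∈ Complex.slitPlane, ‖K z‖ ≤ M * ‖z‖ ^ (-α)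
  upper : ∃ F : ℂ → E, ContinuousOn F ({z | 0 ≤ z.im} \ {0}) ∧ EqOn F K {z | 0 < z.im}
  lower : ∃ F : ℂ → E, ContinuousOn F ({z | z.im ≤ 0} \ {0}) ∧ EqOn F K {z | z.im < 0}

/-- `K` is the Laplace transform of `k` on some right half plane. -/
def IsLaplaceTransform (k : ℝ → E) (K : ℂ → E) : Prop :=
  ∃ σ : ℝ, ∀ z : ℂ, σ < z.re →
    IntegrableOn (fun t : ℝ => Complex.exp (-z * t) • k t) (Ioi 0) ∧
      ∫ t in Ioi (0 : ℝ), Complex.exp (-z * t) • k t = K z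

/-- `K (e ^ (iπ) x)`: the boundary value of `K` at `-x` from above the cut. -/
def upperEdge (K : ℂ → E) (x : ℝ) : E :=
  limUnder (𝓝[{z : ℂ | 0 < z.im}] (-(x : ℂ))) K

/-- `K (e ^ (-iπ) x)`: the boundary value of `K` at `-x` from below the cut. -/
def lowerEdge (K : ℂ → E) (x : ℝ) : E :=
  limUnder (𝓝[{z : ℂ | z.im < 0}] (-(x : ℂ))) K

/-- `G x = (K (e ^ (-iπ) x) - K (e ^ (iπ) x)) / (2 π i)`. -/
def density (K : ℂ → E) (x : ℝ) : E :=
  (1 / (2 * Real.pi * Complex.I) : ℂ) • (lowerEdge K x - upperEdge K x)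

/-- The convolution `c t = ∫₀ᵗ k (t - s) f s ds`. -/
def convolution (k : ℝ → E) (f : ℝ → ℝ) (t : ℝ) : E :=
  ∫ s in (0 : ℝ)..t, f s • k (t - s)

/-- The step sizes `τ_j = t_j - t_{j-1}` (used for `j ≥ 1`). -/
def stepSize (t : ℕ → ℝ) (j : ℕ) : ℝ := t j - t (j - 1)

/-- The implicit Euler approximation `y_n x` of the solution at time `t_n` of
`y' = - x y + f`, `y 0 = 0`. -/
def eulerSol (f : ℝ → ℝ) (t : ℕ → ℝ) (n : ℕ) (x : ℝ) : ℝ :=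
  ∑ j ∈ Finset.Icc 1 n,
    stepSize t j * (∏ l ∈ Finset.Icc j n, 1 / (1 + stepSize t l * x)) * f (t j)

/-- The generalized convolution quadrature approximation
`c_n = ∫₀^∞ G x * y_n x dx` based on the implicit Euler method. -/
def gCQ (K : ℂ → E) (f : ℝ → ℝ) (t : ℕ → ℝ) (n : ℕ) : E :=
  ∫ x in Ioi (0 : ℝ), eulerSol f t n x • density K x

/-- `0 = t_0 < t_1 < ⋯ < t_n`. -/
def IsMesh (t : ℕ → ℝ) (n : ℕ) : Prop :=
  t 0 = 0 ∧ ∀ j < n, t j < t (j + 1)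

/-- The graded mesh `t_n = (n τ) ^ γ` with `τ = T ^ (1 / γ) / N`. -/
def gradedMesh (T γ : ℝ) (N : ℕ) (n : ℕ) : ℝ :=
  ((n : ℝ) * (T ^ (1 / γ) / (N : ℝ))) ^ γ

end

end GCQ

open Set Filter Topology MeasureTheory

set_option linter.unusedSectionVars false

/-! Everything reduces to a scalar ODE. Collapsing a contour onto the cut gives the Stieltjes
formula `K z = ∫ G x / (x + z) dx` for `z > 0` (`IsSectorial.integral_inv_add_smul_density`). The
right side is the Laplace transform of `∫ exp (-t x) G x dx`, so by injectivity this integral is `k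
t` for almost every `t > 0` (`IsSectorial.ae_eq_integral_density`). By Fubini `c (t_n) = ∫ y(t_n, x)
G x dx`, where `y' = -x y + s ^ β`, `y(0) = 0` (`IsSectorial.convolution_eq`). Since `c_n` is the
same integral with the implicit Euler value `y_n(x)`, and `‖G x‖ ≤ M x ^ (-α)`, only `∫ x ^ (-α)
|y(t_n, x) - y_n(x)| dx` has to be bounded.

The scalar error comes from `|y''(s)| ≤ C s ^ (β - 1) / (1 + s x)` (`exists_abs_exactSolDeriv₂_le`).
The local error on `[t_{j-1}, t_j]` is `∫ (s - t_{j-1}) y''(s) ds`, and the Euler step is a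
contraction, so local errors simply add up. On the first interval the exact and the discrete value
are bounded separately by multiples of `t_1 ^ (β + 1) / (1 + t_1 x)`. The scaling `∫ x ^ (-α) / (1 +
s x) dx = A s ^ (α - 1)` turns these bounds into `t_1 ^ (α + β)` and `∫ (s - t_{j-1}) s ^ (α + β -
2) ds`, and a mean value argument yields (a).

For (b), on the graded mesh the `j`-th term is at most a constant times `τ ^ δ j ^ (δ - 2)` with `δ
= γ (α + β)`. The three cases are the three growth regimes of `∑ j ^ (δ - 2)`. -/

/-! ### Elementary estimates and variation of constants on `[s / 2, s]`. -/

theorem rpow_le_two_rpow_abs_mul {r s : ℝ} (p : ℝ) (hs : 0 < s) (h1 : s / 2 ≤ r) (h2 : r ≤ s) :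
    r ^ p ≤ 2 ^ |p| * s ^ p ∧ s ^ p ≤ 2 ^ |p| * r ^ p := by
  have hr : 0 < r := by linarith
  have key : ∀ q : ℝ, 1 ≤ s / r → (s / r) ^ q ≤ 2 ^ |q| := fun q h => by
    calc (s / r) ^ q ≤ (s / r) ^ |q| := Real.rpow_le_rpow_of_exponent_le h (le_abs_self q)
      _ ≤ 2 ^ |q| := by
        refine Real.rpow_le_rpow (by positivity) ?_ (abs_nonneg q)
        rw [div_le_iff₀ hr]; linarith
  have h1' : 1 ≤ s / r := by rw [one_le_div hr]; exact h2
  constructor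
  · have := key (-p) h1'
    rw [abs_neg, Real.rpow_neg (by positivity), Real.div_rpow hs.le hr.le, inv_div,
      div_le_iff₀ (by positivity)] at this
    exact this
  · have := key p h1'
    rw [Real.div_rpow hs.le hr.le, div_le_iff₀ (by positivity)] at this
    exact this

/-- The cube is what `y''` needs: two powers of `1 + s x` are lost in the crude bound at `s / 2`,
and one more pays for the decay `1 / (1 + s x)`. The constant is `6 ^ 3`. -/
theorem exp_neg_half_mul_le {u : ℝ} (hu : 0 ≤ u) :
    Real.exp (-(u / 2)) * (1 + u) ^ 3 ≤ 216 := by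
  have h : (1 + u / 6) ^ 3 ≤ Real.exp (u / 2) := by
    have h1 : 1 + u / 6 ≤ Real.exp (u / 6) := by linarith [Real.add_one_le_exp (u / 6)]
    calc (1 + u / 6) ^ 3 ≤ Real.exp (u / 6) ^ 3 := by gcongr
      _ = Real.exp (u / 2) := by rw [← Real.exp_nat_mul]; congr 1; push_cast; ring
  have h2 : (1 + u) ^ 3 ≤ 216 * Real.exp (u / 2) := by
    calc (1 + u) ^ 3 ≤ (6 * (1 + u / 6)) ^ 3 := by gcongr; linarith
      _ = 216 * (1 + u / 6) ^ 3 := by ring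
      _ ≤ _ := by gcongr
  rw [Real.exp_neg, inv_mul_le_iff₀ (Real.exp_pos _)]
  linarith

/-- The integral `I` satisfies both `I ≤ s` and `x I ≤ 1`; adding the first to `s` times the second
gives the claim. -/
theorem integral_exp_neg_mul_sub_le {x s : ℝ} (hx : 0 ≤ x) (hs : 0 < s) :
    ∫ r in (s / 2)..s, Real.exp (-x * (s - r)) ≤ 2 * s / (1 + s * x) := by
  set I := ∫ r in (s / 2)..s, Real.exp (-x * (s - r)) with hI
  have h1 : I ≤ s := by
    calc I ≤ ∫ r in (s / 2)..s, (1 : ℝ) := by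
          refine intervalIntegral.integral_mono_on (by linarith)
            (Continuous.intervalIntegrable (by fun_prop) _ _) (by simp) fun r hr => ?_
          rw [Real.exp_le_one_iff]
          nlinarith [hr.2]
      _ ≤ s := by simp; linarith
  have h2 : x * I ≤ 1 := by
    have : ∫ r in (s / 2)..s, x * Real.exp (-x * (s - r)) =
        Real.exp (-x * (s - s)) - Real.exp (-x * (s - s / 2)) := by
      refine intervalIntegral.integral_eq_sub_of_hasDerivAt
        (f := fun r => Real.exp (-x * (s - r))) (fun r _ => ?_)
        (Continuous.intervalIntegrable (by fun_prop) _ _)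
      have h := ((((hasDerivAt_id r).const_sub s).const_mul (-x))).exp
      refine h.congr_deriv ?_
      simp [mul_comm]
    rw [intervalIntegral.integral_const_mul] at this
    rw [hI, this]
    simp; positivity
  rw [le_div_iff₀ (by positivity)]
  nlinarith

/-- Variation of constants restarted at `s / 2`. The restart gains `exp (-s x / 2)`, which absorbs
any polynomial in `s x`, and it keeps `r` within a factor two of `s`, so powers of `r` singular at
`0` are harmless. -/
theorem abs_le_of_hasDerivAt_sub_mul {u g : ℝ → ℝ} {x s A B : ℝ} (hx : 0 ≤ x) (hs : 0 < s)
    (hu : ∀ r ∈ Icc (s / 2) s, HasDerivAt u (g r - x * u r) r)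
    (hg : ContinuousOn g (Icc (s / 2) s)) (hA : |u (s / 2)| ≤ A)
    (hB : ∀ r ∈ Icc (s / 2) s, |g r| ≤ B) :
    |u s| ≤ Real.exp (-(s * x / 2)) * A + B * (2 * s / (1 + s * x)) := by
  have hle : s / 2 ≤ s := by linarith
  have hB0 : 0 ≤ B := (abs_nonneg _).trans (hB s ⟨hle, le_rfl⟩)
  have hcont : ContinuousOn (fun r => Real.exp (-x * (s - r)) * g r) (Icc (s / 2) s) :=
    (Continuous.continuousOn (by fun_prop)).mul hg
  have hint : ∫ r in (s / 2)..s, Real.exp (-x * (s - r)) * g r =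
      Real.exp (-x * (s - s)) * u s - Real.exp (-x * (s - s / 2)) * u (s / 2) := by
    refine intervalIntegral.integral_eq_sub_of_hasDerivAt
      (f := fun r => Real.exp (-x * (s - r)) * u r) (fun r hr => ?_)
      (hcont.intervalIntegrable_of_Icc hle)
    rw [uIcc_of_le hle] at hr
    have h := ((((hasDerivAt_id r).const_sub s).const_mul (-x))).exp.mul (hu r hr)
    refine h.congr_deriv ?_
    simp; ring
  have hus : u s = Real.exp (-(s * x / 2)) * u (s / 2) +
      ∫ r in (s / 2)..s, Real.exp (-x * (s - r)) * g r := by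
    rw [hint, show -x * (s - s / 2) = -(s * x / 2) by ring]; simp
  have hI : |∫ r in (s / 2)..s, Real.exp (-x * (s - r)) * g r| ≤ B * (2 * s / (1 + s * x)) := by
    calc |∫ r in (s / 2)..s, Real.exp (-x * (s - r)) * g r|
        ≤ ∫ r in (s / 2)..s, B * Real.exp (-x * (s - r)) := by
          rw [← Real.norm_eq_abs]
          refine intervalIntegral.norm_integral_le_of_norm_le hle ?_
            (Continuous.intervalIntegrable (by fun_prop) _ _)
          refine Eventually.of_forall fun r hr => ?_
          rw [norm_mul, Real.norm_eq_abs, Real.norm_eq_abs, Real.abs_exp, mul_comm]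
          gcongr
          exact hB r ⟨hr.1.le, hr.2⟩
      _ ≤ _ := by
          rw [intervalIntegral.integral_const_mul]
          gcongr
          exact integral_exp_neg_mul_sub_le hx hs
  rw [hus]
  refine (abs_add_le _ _).trans (add_le_add ?_ hI)
  rw [abs_mul, Real.abs_exp]
  gcongr

/-! ### The exact scalar solution and its second derivative. -/

namespace GCQ

/-- The solution at `s` of `y' = - x y + s ^ β`, `y 0 = 0`. -/
noncomputable def exactSol (β x s : ℝ) : ℝ :=
  ∫ r in (0 : ℝ)..s, Real.exp (-x * (s - r)) * r ^ β

theorem intervalIntegrable_exp_mul_rpow {β : ℝ} (hβ : -1 < β) (x s a b : ℝ) :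
    IntervalIntegrable (fun r => Real.exp (-x * (s - r)) * r ^ β) volume a b :=
  (intervalIntegral.intervalIntegrable_rpow' hβ).continuousOn_mul
    (Continuous.continuousOn (by fun_prop))

theorem exactSol_nonneg (β x : ℝ) {s : ℝ} (hs : 0 ≤ s) : 0 ≤ exactSol β x s :=
  intervalIntegral.integral_nonneg hs fun _ hr =>
    mul_nonneg (Real.exp_pos _).le (Real.rpow_nonneg hr.1 _)

theorem exactSol_le {β x s : ℝ} (hβ : -1 < β) (hx : 0 ≤ x) (hs : 0 ≤ s) :
    exactSol β x s ≤ s ^ (β + 1) / (β + 1) := by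
  have h : ∫ r in (0 : ℝ)..s, r ^ β = s ^ (β + 1) / (β + 1) := by
    rw [integral_rpow (Or.inl hβ), Real.zero_rpow (by linarith), sub_zero]
  rw [← h]
  refine intervalIntegral.integral_mono_on hs (intervalIntegrable_exp_mul_rpow hβ x s 0 s)
    (intervalIntegral.intervalIntegrable_rpow' hβ) fun r hr => ?_
  refine mul_le_of_le_one_left (Real.rpow_nonneg hr.1 _) ?_
  rw [Real.exp_le_one_iff]
  nlinarith [hr.2]

theorem hasDerivAt_exactSol {β : ℝ} (hβ : -1 < β) (x : ℝ) {s : ℝ} (hs : 0 < s) :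
    HasDerivAt (exactSol β x) (s ^ β - x * exactSol β x s) s := by
  -- Factoring out `exp (-x s)` frees the integrand of `s`, so the fundamental theorem of calculus
  -- applies.
  have heq : exactSol β x = fun s => Real.exp (-x * s) *
      ∫ r in (0 : ℝ)..s, Real.exp (x * r) * r ^ β := by
    funext s
    rw [exactSol, ← intervalIntegral.integral_const_mul]
    congr 1; funext r
    rw [← mul_assoc, ← Real.exp_add]; congr 2; ring
  have hcont : ContinuousOn (fun r : ℝ => Real.exp (x * r) * r ^ β) (Ioi 0) := fun r hr =>
    ((by fun_prop : Continuous fun r : ℝ => Real.exp (x * r)).continuousAt.mul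
      (Real.continuousAt_rpow_const r β (Or.inl (ne_of_gt hr)))).continuousWithinAt
  have hF : HasDerivAt (fun s => ∫ r in (0 : ℝ)..s, Real.exp (x * r) * r ^ β)
      (Real.exp (x * s) * s ^ β) s := by
    refine intervalIntegral.integral_hasDerivAt_right ?_ ?_ ?_
    · exact (intervalIntegral.intervalIntegrable_rpow' hβ).continuousOn_mul
        (Continuous.continuousOn (by fun_prop))
    · exact hcont.stronglyMeasurableAtFilter isOpen_Ioi s hs
    · exact hcont.continuousAt (Ioi_mem_nhds hs)
  have h := (((hasDerivAt_id s).const_mul (-x)).exp).mul hF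
  rw [heq]
  refine h.congr_deriv ?_
  have he : Real.exp (-x * s) * Real.exp (x * s) = 1 := by
    rw [← Real.exp_add]; simp
  simp only [id, mul_one]
  linear_combination s ^ β * he

/-- The second derivative in time of `exactSol`. -/
noncomputable def exactSolDeriv₂ (β x s : ℝ) : ℝ :=
  β * s ^ (β - 1) - x * (s ^ β - x * exactSol β x s)

theorem hasDerivAt_exactSol_deriv {β : ℝ} (hβ : -1 < β) (x : ℝ) {s : ℝ} (hs : 0 < s) :
    HasDerivAt (fun s => s ^ β - x * exactSol β x s) (exactSolDeriv₂ β x s) s :=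
  (Real.hasDerivAt_rpow_const (Or.inl hs.ne')).sub ((hasDerivAt_exactSol hβ x hs).const_mul x)

theorem hasDerivAt_exactSolDeriv₂ {β : ℝ} (hβ : -1 < β) (x : ℝ) {s : ℝ} (hs : 0 < s) :
    HasDerivAt (exactSolDeriv₂ β x)
      (β * ((β - 1) * s ^ (β - 2)) - x * exactSolDeriv₂ β x s) s := by
  have h := ((Real.hasDerivAt_rpow_const (p := β - 1) (Or.inl hs.ne')).const_mul β).sub
    ((hasDerivAt_exactSol_deriv hβ x hs).const_mul x)
  rw [show β - 1 - 1 = β - 2 by ring] at h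
  exact h

theorem continuousOn_exactSolDeriv₂ {β : ℝ} (hβ : -1 < β) (x : ℝ) :
    ContinuousOn (exactSolDeriv₂ β x) (Ioi 0) := fun _ hs =>
  (hasDerivAt_exactSolDeriv₂ hβ x hs).continuousAt.continuousWithinAt

theorem continuousOn_rpow_const_Icc {s : ℝ} (hs : 0 < s) (p : ℝ) :
    ContinuousOn (fun r : ℝ => r ^ p) (Icc (s / 2) s) := fun r hr =>
  (Real.continuousAt_rpow_const r p (Or.inl (by linarith [hr.1]))).continuousWithinAt

theorem exists_exactSol_le {β : ℝ} (hβ : -1 < β) :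
    ∃ C : ℝ, 0 < C ∧ ∀ x s : ℝ, 0 ≤ x → 0 < s →
      exactSol β x s ≤ C * s ^ (β + 1) / (1 + s * x) := by
  have hb : 0 < β + 1 := by linarith
  refine ⟨216 / (β + 1) + 2 * 2 ^ |β|, by positivity, fun x s hx hs => ?_⟩
  have h := abs_le_of_hasDerivAt_sub_mul (u := exactSol β x) (g := fun r => r ^ β)
    (A := s ^ (β + 1) / (β + 1)) (B := 2 ^ |β| * s ^ β) hx hs
    (fun r hr => hasDerivAt_exactSol hβ x (by linarith [hr.1]))
    (continuousOn_rpow_const_Icc hs β)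
    (by
      rw [abs_of_nonneg (exactSol_nonneg β x (by positivity))]
      refine (exactSol_le hβ hx (by positivity)).trans ?_
      gcongr; linarith)
    (fun r hr => by
      rw [abs_of_nonneg (Real.rpow_nonneg (by linarith [hr.1]) _)]
      exact (rpow_le_two_rpow_abs_mul β hs hr.1 hr.2).1)
  refine (le_abs_self _).trans (h.trans ?_)
  have hu : 0 ≤ s * x := by positivity
  have he : Real.exp (-(s * x / 2)) ≤ 216 / (1 + s * x) := by
    rw [le_div_iff₀ (by positivity)]
    refine le_trans ?_ (exp_neg_half_mul_le hu)
    gcongr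
    exact le_self_pow₀ (by linarith) (by norm_num)
  have hsb : s ^ (β + 1) = s ^ β * s := Real.rpow_add_one hs.ne' β
  calc _ ≤ 216 / (1 + s * x) * (s ^ (β + 1) / (β + 1)) +
        2 ^ |β| * s ^ β * (2 * s / (1 + s * x)) := by gcongr
    _ = _ := by rw [hsb]; field_simp

/-- Differentiating twice, `y''` solves the same linear equation with source `β (β - 1) s ^ (β -
2)`. At `s / 2` the explicit formula gives only `s ^ (β - 1) (1 + s x) ^ 2`, and the exponential
factor of the restart removes that growth. -/
theorem exists_abs_exactSolDeriv₂_le {β : ℝ} (hβ : -1 < β) :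
    ∃ C : ℝ, 0 < C ∧ ∀ x s : ℝ, 0 ≤ x → 0 < s →
      |exactSolDeriv₂ β x s| ≤ C * s ^ (β - 1) / (1 + s * x) := by
  have hb : 0 < β + 1 := by linarith
  set D : ℝ := |β| * 2 ^ |β - 1| + 2 ^ |β| + 1 / (β + 1) with hD
  refine ⟨216 * D + 2 * (|β| * (|β - 1| * 2 ^ |β - 2|)) , by positivity, fun x s hx hs => ?_⟩
  have hu : 0 ≤ s * x := by positivity
  have hs1 : s ^ β = s ^ (β - 1) * s := by
    rw [← Real.rpow_add_one hs.ne']; congr 1; ring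
  have hs2 : s ^ (β + 1) = s ^ (β - 1) * s ^ 2 := by
    rw [← Real.rpow_add_natCast hs.ne']; congr 1; push_cast; ring
  have hs3 : s ^ (β - 1) = s ^ (β - 2) * s := by
    rw [← Real.rpow_add_one hs.ne']; congr 1; ring
  have hhalf : ∀ p : ℝ, (s / 2) ^ p ≤ 2 ^ |p| * s ^ p := fun p =>
    (rpow_le_two_rpow_abs_mul p hs le_rfl (by linarith)).1
  have hA : |exactSolDeriv₂ β x (s / 2)| ≤ D * s ^ (β - 1) * (1 + s * x) ^ 2 := by
    have hy0 := exactSol_nonneg β x (s := s / 2) (by positivity)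
    have hy : exactSol β x (s / 2) ≤ s ^ (β + 1) / (β + 1) := by
      refine (exactSol_le hβ hx (by positivity)).trans ?_
      gcongr; linarith
    have e : exactSolDeriv₂ β x (s / 2) = β * (s / 2) ^ (β - 1) + -(x * (s / 2) ^ β) +
        x ^ 2 * exactSol β x (s / 2) := by rw [exactSolDeriv₂]; ring
    have p1 : 0 ≤ (s / 2) ^ (β - 1) := by positivity
    have p2 : 0 ≤ (s / 2) ^ β := by positivity
    calc |exactSolDeriv₂ β x (s / 2)|
        ≤ |β| * (s / 2) ^ (β - 1) + x * (s / 2) ^ β + x ^ 2 * exactSol β x (s / 2) := by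
          rw [e]
          refine (abs_add_three _ _ _).trans ?_
          rw [abs_neg, abs_mul, abs_mul, abs_mul, abs_of_nonneg p1, abs_of_nonneg p2,
            abs_of_nonneg hx, abs_of_nonneg hy0, abs_of_nonneg (sq_nonneg x)]
      _ ≤ |β| * (2 ^ |β - 1| * s ^ (β - 1)) + x * (2 ^ |β| * s ^ β) +
          x ^ 2 * (s ^ (β + 1) / (β + 1)) := by
          gcongr <;> exact hhalf _
      _ = (|β| * 2 ^ |β - 1| * 1 + 2 ^ |β| * (s * x) + 1 / (β + 1) * (s * x) ^ 2) *
          s ^ (β - 1) := by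
          rw [hs1, hs2]; ring
      _ ≤ (|β| * 2 ^ |β - 1| * (1 + s * x) ^ 2 + 2 ^ |β| * (1 + s * x) ^ 2 +
          1 / (β + 1) * (1 + s * x) ^ 2) * s ^ (β - 1) := by
          gcongr
          · nlinarith
          · nlinarith
          · linarith
      _ = _ := by rw [hD]; ring
  have h := abs_le_of_hasDerivAt_sub_mul (u := exactSolDeriv₂ β x)
    (g := fun r => β * ((β - 1) * r ^ (β - 2)))
    (B := |β| * (|β - 1| * (2 ^ |β - 2| * s ^ (β - 2)))) hx hs
    (fun r hr => hasDerivAt_exactSolDeriv₂ hβ x (by linarith [hr.1]))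
    (((continuousOn_rpow_const_Icc hs _).const_smul (β - 1)).const_smul β) hA
    (fun r hr => by
      rw [abs_mul, abs_mul, abs_of_nonneg (Real.rpow_nonneg (by linarith [hr.1]) (β - 2))]
      gcongr
      exact (rpow_le_two_rpow_abs_mul _ hs hr.1 hr.2).1)
  refine h.trans ?_
  have he : Real.exp (-(s * x / 2)) * (1 + s * x) ^ 2 ≤ 216 / (1 + s * x) := by
    rw [le_div_iff₀ (by positivity)]
    refine le_of_eq_of_le ?_ (exp_neg_half_mul_le hu)
    ring
  calc _ = (Real.exp (-(s * x / 2)) * (1 + s * x) ^ 2) * (D * s ^ (β - 1)) +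
        |β| * (|β - 1| * (2 ^ |β - 2| * s ^ (β - 2))) * (2 * s / (1 + s * x)) := by ring
    _ ≤ 216 / (1 + s * x) * (D * s ^ (β - 1)) +
        |β| * (|β - 1| * (2 ^ |β - 2| * s ^ (β - 2))) * (2 * s / (1 + s * x)) := by gcongr
    _ = _ := by rw [hs3]; field_simp

end GCQ

/-! ### Integrals over the cut variable `x`, and a mean value bound. -/

theorem integrableOn_rpow_neg_div_one_add {α : ℝ} (hα0 : 0 < α) (hα1 : α < 1) :
    IntegrableOn (fun x : ℝ => x ^ (-α) / (1 + x)) (Ioi 0) := by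
  have hc : ∀ S ⊆ Ioi (0 : ℝ), MeasurableSet S →
      AEStronglyMeasurable (fun x : ℝ => x ^ (-α) / (1 + x)) (volume.restrict S) := fun S _ _ =>
    (by fun_prop : Measurable fun x : ℝ => x ^ (-α) / (1 + x)).aestronglyMeasurable
  rw [← Ioc_union_Ioi_eq_Ioi zero_le_one]
  refine IntegrableOn.union ?_ ?_
  · have h : IntegrableOn (fun x : ℝ => x ^ (-α)) (Ioc 0 1) :=
      (intervalIntegrable_iff_integrableOn_Ioc_of_le zero_le_one).1
        (intervalIntegral.intervalIntegrable_rpow' (by linarith))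
    refine h.mono' (hc _ Ioc_subset_Ioi_self measurableSet_Ioc) ?_
    refine (ae_restrict_iff' measurableSet_Ioc).2 (Eventually.of_forall fun x hx => ?_)
    have hx0 : 0 < x := hx.1
    rw [Real.norm_of_nonneg (by positivity)]
    exact div_le_self (by positivity) (by linarith)
  · have h : IntegrableOn (fun x : ℝ => x ^ (-α - 1)) (Ioi 1) :=
      integrableOn_Ioi_rpow_of_lt (by linarith) zero_lt_one
    refine h.mono' (hc _ (Ioi_subset_Ioi zero_le_one) measurableSet_Ioi) ?_
    refine (ae_restrict_iff' measurableSet_Ioi).2 (Eventually.of_forall fun x hx => ?_)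
    have hx0 : 0 < x := zero_lt_one.trans hx
    rw [Real.norm_of_nonneg (by positivity), Real.rpow_sub_one hx0.ne']
    gcongr
    linarith

theorem rpow_neg_div_one_add_mul {α s x : ℝ} (hs : 0 < s) (hx : 0 < x) :
    x ^ (-α) / (1 + s * x) = s ^ α * ((s * x) ^ (-α) / (1 + s * x)) := by
  rw [Real.mul_rpow hs.le hx.le, mul_div_assoc', ← mul_assoc, ← Real.rpow_add hs]
  simp

theorem integrableOn_rpow_neg_div_one_add_mul {α s : ℝ} (hα0 : 0 < α) (hα1 : α < 1)
    (hs : 0 < s) : IntegrableOn (fun x : ℝ => x ^ (-α) / (1 + s * x)) (Ioi 0) := by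
  have h := (integrableOn_Ioi_comp_mul_left_iff (fun x : ℝ => x ^ (-α) / (1 + x)) 0 hs).2
    (by simpa using integrableOn_rpow_neg_div_one_add hα0 hα1)
  exact IntegrableOn.congr_fun (h.const_mul (s ^ α))
    (fun x hx => (rpow_neg_div_one_add_mul hs hx).symm) measurableSet_Ioi

theorem integral_rpow_neg_div_one_add_mul {α s : ℝ} (hs : 0 < s) :
    ∫ x in Ioi (0 : ℝ), x ^ (-α) / (1 + s * x) =
      s ^ (α - 1) * ∫ x in Ioi (0 : ℝ), x ^ (-α) / (1 + x) := by
  rw [setIntegral_congr_fun measurableSet_Ioi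
    (fun x hx => rpow_neg_div_one_add_mul (α := α) hs hx), integral_const_mul,
    integral_comp_mul_left_Ioi (fun x : ℝ => x ^ (-α) / (1 + x)) 0 hs, smul_eq_mul, mul_zero,
    ← mul_assoc, Real.rpow_sub_one hs.ne', div_eq_mul_inv]

/-- Fubini for `x ^ (-α) g(s) / (1 + s x)` on `[a, b] × (0, ∞)`. -/
theorem integrable_and_integral_rpow_neg_mul_integral {α a b : ℝ} (hα0 : 0 < α) (hα1 : α < 1)
    (ha : 0 < a) (hab : a ≤ b) {g : ℝ → ℝ} (hg : ContinuousOn g (Icc a b)) :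
    IntegrableOn (fun x : ℝ => x ^ (-α) * ∫ s in a..b, g s / (1 + s * x)) (Ioi 0) ∧
    ∫ x in Ioi (0 : ℝ), x ^ (-α) * ∫ s in a..b, g s / (1 + s * x) =
      (∫ x in Ioi (0 : ℝ), x ^ (-α) / (1 + x)) * ∫ s in a..b, g s * s ^ (α - 1) := by
  have hgi : IntegrableOn g (Ioc a b) := hg.integrableOn_Icc.mono_set Ioc_subset_Icc_self
  have hprod : Integrable (fun p : ℝ × ℝ => p.1 ^ (-α) * (g p.2 / (1 + p.2 * p.1)))
      ((volume.restrict (Ioi 0)).prod (volume.restrict (Ioc a b))) := by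
    -- For `s ≥ a` one has `1 + s x ≥ 1 + a x`, so a product of a function of `x` and a function of
    -- `s` dominates.
    have h := (integrableOn_rpow_neg_div_one_add_mul hα0 hα1 ha).integrable.mul_prod hgi.integrable
    refine h.mono ?_ ?_
    · have h1 : Measurable fun p : ℝ × ℝ => p.1 ^ (-α) := by fun_prop
      have h2 : Measurable fun p : ℝ × ℝ => 1 + p.2 * p.1 := by fun_prop
      exact h1.aestronglyMeasurable.mul (hgi.aestronglyMeasurable.comp_snd.div₀
        h2.aestronglyMeasurable)
    · rw [Measure.prod_restrict]
      refine (ae_restrict_iff' (measurableSet_Ioi.prod measurableSet_Ioc)).2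
        (Eventually.of_forall fun p hp => ?_)
      have hx : 0 < p.1 := hp.1
      have hs : a < p.2 := hp.2.1
      have hs0 : 0 < p.2 := ha.trans hs
      rw [norm_mul, norm_mul, norm_div, norm_div, Real.norm_of_nonneg (by positivity :
        0 ≤ p.1 ^ (-α)), Real.norm_of_nonneg (by positivity : 0 ≤ 1 + p.2 * p.1),
        Real.norm_of_nonneg (by positivity : 0 ≤ 1 + a * p.1), div_mul_eq_mul_div, ← mul_div_assoc]
      gcongr
  have e1 : ∀ x : ℝ, x ^ (-α) * ∫ s in a..b, g s / (1 + s * x) =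
      ∫ s in Ioc a b, x ^ (-α) * (g s / (1 + s * x)) := fun x => by
    rw [intervalIntegral.integral_of_le hab, integral_const_mul]
  simp only [e1]
  refine ⟨hprod.integral_prod_left, ?_⟩
  rw [integral_integral_swap hprod, intervalIntegral.integral_of_le hab, ← integral_const_mul]
  refine setIntegral_congr_fun measurableSet_Ioc fun s hs => ?_
  have hs0 : 0 < s := ha.trans hs.1
  calc ∫ x in Ioi (0 : ℝ), x ^ (-α) * (g s / (1 + s * x))
      = ∫ x in Ioi (0 : ℝ), g s * (x ^ (-α) / (1 + s * x)) := by
        congr 1; funext x; ring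
    _ = _ := by
        rw [integral_const_mul, integral_rpow_neg_div_one_add_mul hs0]; ring

/-- If the bound failed at every `ξ`, then `g < I / (b - a) ^ 2` throughout for the integral `I`;
integrating against `s - a` gives `I ≤ I / 2`, impossible because `g > 0` forces `I > 0`. -/
theorem exists_integral_sub_mul_le {a b : ℝ} (hab : a < b) {g : ℝ → ℝ}
    (hg : ContinuousOn g (Icc a b)) (hpos : ∀ s ∈ Ioo a b, 0 < g s) :
    ∃ ξ ∈ Ioo a b, ∫ s in a..b, (s - a) * g s ≤ (b - a) ^ 2 * g ξ := by
  by_contra! h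
  set I := ∫ s in a..b, (s - a) * g s
  have hab0 : 0 < b - a := sub_pos.2 hab
  have hI : 0 < I := by
    obtain ⟨ξ, hξ⟩ := nonempty_Ioo.2 hab
    have := h ξ hξ
    have := hpos ξ hξ
    nlinarith [mul_pos (pow_pos hab0 2) this]
  have h1 : I ≤ ∫ s in a..b, (s - a) * (I / (b - a) ^ 2) := by
    refine intervalIntegral.integral_mono_on_of_le_Ioo hab.le
      (ContinuousOn.intervalIntegrable_of_Icc hab.le ((by fun_prop :
        Continuous fun s : ℝ => s - a).continuousOn.mul hg))
      (Continuous.intervalIntegrable (by fun_prop) _ _) fun s hs => ?_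
    have : g s ≤ I / (b - a) ^ 2 := by
      rw [le_div_iff₀ (by positivity), mul_comm]; exact (h s hs).le
    exact mul_le_mul_of_nonneg_left this (by linarith [hs.1])
  have h2 : ∫ s in a..b, (s - a) * (I / (b - a) ^ 2) = I / 2 := by
    rw [intervalIntegral.integral_mul_const, intervalIntegral.integral_sub
      (by simp) (by simp), integral_id]
    simp only [intervalIntegral.integral_const, smul_eq_mul]
    field_simp; ring
  linarith

/-! ### Error of the implicit Euler method for the scalar equation. -/

namespace GCQ

theorem IsMesh.of_succ {t : ℕ → ℝ} {n : ℕ} (h : IsMesh t (n + 1)) : IsMesh t n :=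
  ⟨h.1, fun j hj => h.2 j (by omega)⟩

theorem IsMesh.pos {t : ℕ → ℝ} {n : ℕ} (h : IsMesh t n) {j : ℕ} (h1 : 1 ≤ j) (hj : j ≤ n) :
    0 < t j := by
  induction j, h1 using Nat.le_induction with
  | base => simpa [h.1] using h.2 0 (by omega)
  | succ j hj1 ih => exact (ih (by omega)).trans (h.2 j (by omega))

theorem IsMesh.stepSize_pos {t : ℕ → ℝ} {n : ℕ} (h : IsMesh t n) {j : ℕ} (h1 : 1 ≤ j)
    (hj : j ≤ n) : 0 < stepSize t j := by
  have := h.2 (j - 1) (by omega)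
  rw [Nat.sub_add_cancel h1] at this
  exact sub_pos.2 this

theorem eulerSol_zero (f : ℝ → ℝ) (t : ℕ → ℝ) (x : ℝ) : eulerSol f t 0 x = 0 := by
  simp [eulerSol]

theorem eulerSol_succ (f : ℝ → ℝ) (t : ℕ → ℝ) (n : ℕ) (x : ℝ) :
    eulerSol f t (n + 1) x = (eulerSol f t n x + stepSize t (n + 1) * f (t (n + 1))) /
      (1 + stepSize t (n + 1) * x) := by
  rw [eulerSol, Finset.sum_Icc_succ_top (by omega), eulerSol, add_div, Finset.sum_div]
  congr 1
  · refine Finset.sum_congr rfl fun j hj => ?_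
    rw [Finset.prod_Icc_succ_top (by have := (Finset.mem_Icc.1 hj).2; omega)]
    ring
  · simp; ring

/-- Taylor expansion about the right endpoint: `(s - a) y' - y` is an antiderivative of `(s - a)
y''`, so the defect of the exact solution in the Euler step is minus the integral of the latter. -/
theorem exactSol_local_error {β C x a b : ℝ} (hβ : -1 < β) (hx : 0 ≤ x) (ha : 0 < a)
    (hab : a < b)
    (hC : ∀ s : ℝ, 0 < s → |exactSolDeriv₂ β x s| ≤ C * s ^ (β - 1) / (1 + s * x)) :
    |exactSol β x b * (1 + (b - a) * x) - (exactSol β x a + (b - a) * b ^ β)| ≤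
      C * ∫ s in a..b, (s - a) * s ^ (β - 1) / (1 + s * x) := by
  have hsub : Icc a b ⊆ Ioi 0 := fun s hs => ha.trans_le hs.1
  have hc : ContinuousOn (fun s => (s - a) * exactSolDeriv₂ β x s) (Icc a b) :=
    (by fun_prop : Continuous fun s : ℝ => s - a).continuousOn.mul
      ((continuousOn_exactSolDeriv₂ hβ x).mono hsub)
  have hint : ∫ s in a..b, (s - a) * exactSolDeriv₂ β x s =
      ((b - a) * (b ^ β - x * exactSol β x b) - exactSol β x b) -
      ((a - a) * (a ^ β - x * exactSol β x a) - exactSol β x a) := by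
    refine intervalIntegral.integral_eq_sub_of_hasDerivAt
      (f := fun s => (s - a) * (s ^ β - x * exactSol β x s) - exactSol β x s) (fun s hs => ?_)
      (hc.intervalIntegrable_of_Icc hab.le)
    rw [uIcc_of_le hab.le] at hs
    have hs0 : 0 < s := hsub hs
    have h := (((hasDerivAt_id s).sub_const a).mul (hasDerivAt_exactSol_deriv hβ x hs0)).sub
      (hasDerivAt_exactSol hβ x hs0)
    refine h.congr_deriv ?_
    simp
  have e : exactSol β x b * (1 + (b - a) * x) - (exactSol β x a + (b - a) * b ^ β) =
      -∫ s in a..b, (s - a) * exactSolDeriv₂ β x s := by rw [hint]; ring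
  rw [e, abs_neg, ← intervalIntegral.integral_const_mul, ← Real.norm_eq_abs]
  refine intervalIntegral.norm_integral_le_of_norm_le hab.le ?_ ?_
  · refine Eventually.of_forall fun s hs => ?_
    have h1 : 0 < s - a := sub_pos.2 hs.1
    rw [norm_mul, Real.norm_of_nonneg h1.le, Real.norm_eq_abs]
    calc _ ≤ (s - a) * (C * s ^ (β - 1) / (1 + s * x)) := by
          gcongr; exact hC s (ha.trans hs.1)
      _ = _ := by ring
  · refine ContinuousOn.intervalIntegrable_of_Icc hab.le fun s hs => ?_
    have hs0 : 0 < s := hsub hs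
    have : 1 + s * x ≠ 0 := by positivity
    have h1 : ContinuousAt (fun s : ℝ => s ^ (β - 1)) s :=
      Real.continuousAt_rpow_const _ _ (Or.inl hs0.ne')
    exact ContinuousAt.continuousWithinAt (by fun_prop (disch := assumption))

theorem abs_exactSol_sub_eulerSol_le {β C₁ C₂ x : ℝ} (hβ : -1 < β) (hx : 0 ≤ x)
    (hC₁ : ∀ s : ℝ, 0 < s → exactSol β x s ≤ C₁ * s ^ (β + 1) / (1 + s * x))
    (hC₂ : ∀ s : ℝ, 0 < s → |exactSolDeriv₂ β x s| ≤ C₂ * s ^ (β - 1) / (1 + s * x))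
    {n : ℕ} {t : ℕ → ℝ} (hn : 1 ≤ n) (ht : IsMesh t n) :
    |exactSol β x (t n) - eulerSol (fun s => s ^ β) t n x| ≤
      (C₁ + 1) * t 1 ^ (β + 1) / (1 + t 1 * x) +
        ∑ j ∈ Finset.Icc 2 n,
          C₂ * ∫ s in (t (j - 1))..(t j), (s - t (j - 1)) * s ^ (β - 1) / (1 + s * x) := by
  induction n, hn using Nat.le_induction with
  | base =>
    have h1 : 0 < t 1 := ht.pos le_rfl le_rfl
    have e : eulerSol (fun s => s ^ β) t 1 x = t 1 ^ (β + 1) / (1 + t 1 * x) := by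
      rw [eulerSol_succ, eulerSol_zero, stepSize, Real.rpow_add_one h1.ne']
      simp [ht.1, mul_comm]
    rw [e]
    simp only [Finset.Icc_eq_empty_of_lt (show 1 < 2 by norm_num), Finset.sum_empty, add_zero]
    have h2 := hC₁ _ h1
    have h3 := exactSol_nonneg β x h1.le
    have h4 : 0 ≤ t 1 ^ (β + 1) / (1 + t 1 * x) := by positivity
    have h5 : (C₁ + 1) * t 1 ^ (β + 1) / (1 + t 1 * x) =
      C₁ * t 1 ^ (β + 1) / (1 + t 1 * x) + t 1 ^ (β + 1) / (1 + t 1 * x) := by ring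
    rw [h5, abs_le]
    constructor <;> linarith
  | succ n hn ih =>
    have hpos : 0 < t n := ht.of_succ.pos hn le_rfl
    have hlt : t n < t (n + 1) := ht.2 n (by omega)
    have hloc := exactSol_local_error hβ hx hpos hlt hC₂
    have hst : 0 < stepSize t (n + 1) := ht.stepSize_pos (by omega) le_rfl
    have hst' : stepSize t (n + 1) = t (n + 1) - t n := rfl
    rw [Finset.sum_Icc_succ_top (by omega), ← add_assoc]
    refine le_trans ?_ (add_le_add (ih ht.of_succ) hloc)
    -- Stability: the old error and the new defect are both divided by `1 + τ x ≥ 1`, hence never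
    -- amplified.
    have hd : 1 ≤ 1 + stepSize t (n + 1) * x := by nlinarith [mul_nonneg hst.le hx]
    have e : exactSol β x (t (n + 1)) - eulerSol (fun s => s ^ β) t (n + 1) x =
        ((exactSol β x (t n) - eulerSol (fun s => s ^ β) t n x) +
          (exactSol β x (t (n + 1)) * (1 + (t (n + 1) - t n) * x) -
            (exactSol β x (t n) + (t (n + 1) - t n) * t (n + 1) ^ β))) /
        (1 + stepSize t (n + 1) * x) := by
      rw [eulerSol_succ, eq_div_iff (by linarith), sub_mul, div_mul_cancel₀ _ (by linarith), hst']
      ring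
    rw [e, abs_div, abs_of_nonneg (by linarith : 0 ≤ 1 + stepSize t (n + 1) * x)]
    exact (div_le_self (abs_nonneg _) hd).trans (abs_add_le _ _)

/-- `B` and `ξ` are built from the mesh alone, before any `K` appears, so the same points serve
every kernel. -/
theorem exists_error_majorant {α β : ℝ} (hα0 : 0 < α) (hα1 : α < 1) (hβ : -1 < β) :
    ∃ C : ℝ, 0 < C ∧ ∀ (n : ℕ) (t : ℕ → ℝ), 1 ≤ n → IsMesh t n →
      ∃ B : ℝ → ℝ, IntegrableOn B (Ioi 0) ∧
        (∀ x : ℝ, 0 < x →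
          x ^ (-α) * |exactSol β x (t n) - eulerSol (fun s => s ^ β) t n x| ≤ B x) ∧
        ∃ ξ : ℕ → ℝ, (∀ j ∈ Finset.Icc 2 n, ξ j ∈ Ioo (t (j - 1)) (t j)) ∧
          ∫ x in Ioi (0 : ℝ), B x ≤ C * (stepSize t 1 ^ (α + β) +
            ∑ j ∈ Finset.Icc 2 n, stepSize t j ^ 2 * ξ j ^ (α + β - 2)) := by
  obtain ⟨C₁, hC₁, h₁⟩ := exists_exactSol_le hβ
  obtain ⟨C₂, hC₂, h₂⟩ := exists_abs_exactSolDeriv₂_le hβ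
  set A := ∫ x in Ioi (0 : ℝ), x ^ (-α) / (1 + x) with hA
  have hA0 : 0 ≤ A := setIntegral_nonneg measurableSet_Ioi fun x hx => by
    have : (0 : ℝ) < x := hx
    positivity
  refine ⟨(C₁ + 1 + C₂) * (A + 1), by positivity, fun n t hn ht => ?_⟩
  have hpos : ∀ j ∈ Finset.Icc 2 n, 0 < t (j - 1) ∧ t (j - 1) < t j := fun j hj => by
    rw [Finset.mem_Icc] at hj
    exact ⟨ht.pos (by omega) (by omega), sub_pos.1 (ht.stepSize_pos (by omega) hj.2)⟩
  have hcont : ∀ p : ℝ, ∀ j ∈ Finset.Icc 2 n,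
      ContinuousOn (fun s : ℝ => s ^ p) (Icc (t (j - 1)) (t j)) := fun p j hj s hs =>
    (Real.continuousAt_rpow_const _ _
      (Or.inl ((hpos j hj).1.trans_le hs.1).ne')).continuousWithinAt
  have hξ : ∀ j ∈ Finset.Icc 2 n, ∃ ξ ∈ Ioo (t (j - 1)) (t j),
      ∫ s in (t (j - 1))..(t j), (s - t (j - 1)) * s ^ (α + β - 2) ≤
        (t j - t (j - 1)) ^ 2 * ξ ^ (α + β - 2) := fun j hj =>
    exists_integral_sub_mul_le (hpos j hj).2 (hcont _ j hj) fun s hs =>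
      Real.rpow_pos_of_pos ((hpos j hj).1.trans hs.1) _
  choose! ξ hξ1 hξ2 using hξ
  have hF := fun j (hj : j ∈ Finset.Icc 2 n) =>
    integrable_and_integral_rpow_neg_mul_integral hα0 hα1 (hpos j hj).1 (hpos j hj).2.le
      (g := fun s => (s - t (j - 1)) * s ^ (β - 1))
      ((by fun_prop : Continuous fun s : ℝ => s - t (j - 1)).continuousOn.mul
        (hcont (β - 1) j hj))
  have ht1 : 0 < t 1 := ht.pos le_rfl hn
  have hi1 := integrableOn_rpow_neg_div_one_add_mul hα0 hα1 ht1
  set B₁ : ℝ → ℝ := fun x => (C₁ + 1) * t 1 ^ (β + 1) * (x ^ (-α) / (1 + t 1 * x)) with hB₁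
  set B₂ : ℕ → ℝ → ℝ := fun j x => C₂ * (x ^ (-α) *
    ∫ s in (t (j - 1))..(t j), (s - t (j - 1)) * s ^ (β - 1) / (1 + s * x)) with hB₂
  have hB₂i : ∀ j ∈ Finset.Icc 2 n, IntegrableOn (B₂ j) (Ioi 0) := fun j hj =>
    (hF j hj).1.const_mul C₂
  have hB₁i : IntegrableOn B₁ (Ioi 0) := hi1.const_mul _
  refine ⟨fun x => B₁ x + ∑ j ∈ Finset.Icc 2 n, B₂ j x,
    hB₁i.add (integrable_finsetSum _ hB₂i), fun x hx => ?_, ξ, hξ1, ?_⟩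
  · have h := abs_exactSol_sub_eulerSol_le hβ hx.le (fun s hs => h₁ x s hx.le hs)
      (fun s hs => h₂ x s hx.le hs) hn ht
    refine (mul_le_mul_of_nonneg_left h (by positivity)).trans (le_of_eq ?_)
    rw [mul_add, Finset.mul_sum]
    congr 1
    · rw [hB₁]; ring
    · refine Finset.sum_congr rfl fun j _ => ?_
      rw [hB₂]; ring
  · rw [integral_add hB₁i (integrable_finsetSum _ hB₂i), integral_finsetSum _ hB₂i, mul_add,
      Finset.mul_sum]
    refine add_le_add ?_ (Finset.sum_le_sum fun j hj => ?_)
    · rw [hB₁, integral_const_mul, integral_rpow_neg_div_one_add_mul ht1, ← hA, stepSize]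
      have e : t 1 ^ (α + β) = t 1 ^ (β + 1) * t 1 ^ (α - 1) := by
        rw [← Real.rpow_add ht1]; congr 1; ring
      simp only [Nat.sub_self, ht.1, sub_zero]
      rw [e]
      calc _ = (C₁ + 1) * A * (t 1 ^ (β + 1) * t 1 ^ (α - 1)) := by ring
        _ ≤ _ := by
            refine mul_le_mul_of_nonneg_right ?_ (by positivity)
            exact mul_le_mul (by linarith) (by linarith) hA0 (by positivity)
    · have h0 := (hpos j hj).1
      have e : ∫ s in (t (j - 1))..(t j), (s - t (j - 1)) * s ^ (β - 1) * s ^ (α - 1) =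
          ∫ s in (t (j - 1))..(t j), (s - t (j - 1)) * s ^ (α + β - 2) := by
        refine intervalIntegral.integral_congr fun s hs => ?_
        rw [uIcc_of_le (hpos j hj).2.le] at hs
        rw [mul_assoc, ← Real.rpow_add (h0.trans_le hs.1)]
        congr 2; ring
      have hξ0 : 0 < ξ j := h0.trans (hξ1 j hj).1
      rw [hB₂, integral_const_mul, (hF j hj).2, ← hA, e]
      calc _ ≤ C₂ * (A * ((t j - t (j - 1)) ^ 2 * ξ j ^ (α + β - 2))) := by
            gcongr; exact hξ2 j hj
        _ = C₂ * A * (stepSize t j ^ 2 * ξ j ^ (α + β - 2)) := by rw [stepSize]; ring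
        _ ≤ _ := by gcongr <;> linarith

end GCQ

/-! ### Boundary values of `K` on the cut, and the logarithmic strip. -/

theorem Complex.exp_mem_slitPlane_of_abs_im_lt {s : ℂ} (hs : |s.im| < Real.pi) :
    Complex.exp s ∈ Complex.slitPlane := by
  rw [Complex.mem_slitPlane_iff, Complex.exp_re, Complex.exp_im]
  rw [abs_lt] at hs
  rcases eq_or_ne s.im 0 with h | h
  · left; rw [h, Real.cos_zero, mul_one]; exact Real.exp_pos _
  · right
    refine mul_ne_zero (Real.exp_pos _).ne' ?_
    rcases lt_or_gt_of_ne h with h | h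
    · exact (Real.sin_neg_of_neg_of_neg_pi_lt h hs.1).ne
    · exact (Real.sin_pos_of_pos_of_lt_pi h hs.2).ne'

theorem Complex.exp_eq_neg_exp_re_of_im_eq {s : ℂ} (hs : s.im = Real.pi ∨ s.im = -Real.pi) :
    Complex.exp s = -(Real.exp s.re : ℂ) := by
  apply Complex.ext <;> rcases hs with h | h <;>
    simp [Complex.exp_re, Complex.exp_im, h, -Complex.ofReal_exp]

/-- Two logarithms differ by a multiple of `2 π i`, and within the closed strip none but zero can
separate `s` from a real point. -/
theorem Complex.eq_ofReal_of_exp_eq {s : ℂ} {a : ℝ} (hs : |s.im| ≤ Real.pi)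
    (h : Complex.exp s = Real.exp a) : s = a := by
  rw [Complex.ofReal_exp, Complex.exp_eq_exp_iff_exists_int] at h
  obtain ⟨n, hn⟩ := h
  have him : s.im = n * (2 * Real.pi) := by
    rw [hn]; simp [Complex.add_im, Complex.mul_im]
  have hn0 : n = 0 := by
    rw [him, abs_mul, abs_of_pos Real.two_pi_pos] at hs
    have h1 : |(n : ℝ)| < 1 := by nlinarith [Real.pi_pos]
    exact Int.abs_lt_one_iff.1 (by exact_mod_cast h1)
  simpa [hn0] using hn

namespace GCQ

variable {E : Type*} [NormedAddCommGroup E] [NormedSpace ℂ E]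

theorem limUnder_eq_of_eqOn {K F : ℂ → E} {U : Set ℂ} {w : ℂ} (hFK : EqOn F K U)
    (hw : w ∈ closure U) (hF : ContinuousWithinAt F U w) : limUnder (𝓝[U] w) K = F w := by
  have : NeBot (𝓝[U] w) := mem_closure_iff_nhdsWithin_neBot.1 hw
  exact (hF.tendsto.congr' (eventually_nhdsWithin_of_forall hFK)).limUnder_eq

theorem IsSectorial.norm_le_of_mem_closure {K F : ℂ → E} {M α : ℝ} (h : IsSectorial K M α)
    {U : Set ℂ} (hU : U ⊆ Complex.slitPlane) {w : ℂ} (hFK : EqOn F K U) (hw : w ∈ closure U)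
    (hF : ContinuousWithinAt F U w) (hw0 : w ≠ 0) : ‖F w‖ ≤ M * ‖w‖ ^ (-α) := by
  have : NeBot (𝓝[U] w) := mem_closure_iff_nhdsWithin_neBot.1 hw
  have hr : ContinuousAt (fun v : ℂ => M * ‖v‖ ^ (-α)) w :=
    (continuous_norm.continuousAt.rpow_const (Or.inl (norm_ne_zero_iff.2 hw0))).const_mul M
  refine le_of_tendsto_of_tendsto hF.norm.tendsto (hr.mono_left nhdsWithin_le_nhds) ?_
  refine eventually_nhdsWithin_of_forall fun v hv => ?_
  beta_reduce
  rw [hFK hv]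
  exact h.norm_le v (hU hv)

theorem setOf_im_pos_subset_slitPlane : {z : ℂ | 0 < z.im} ⊆ Complex.slitPlane :=
  fun _ hz => Complex.mem_slitPlane_iff.2 (Or.inr (ne_of_gt hz))

theorem setOf_im_neg_subset_slitPlane : {z : ℂ | z.im < 0} ⊆ Complex.slitPlane :=
  fun _ hz => Complex.mem_slitPlane_iff.2 (Or.inr (ne_of_lt hz))

theorem IsSectorial.exists_upper {K : ℂ → E} {M α : ℝ} (h : IsSectorial K M α) :
    ∃ F : ℂ → E, ContinuousOn F ({z | 0 ≤ z.im} \ {0}) ∧ EqOn F K {z | 0 < z.im} ∧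
      ∀ x : ℝ, 0 < x → upperEdge K x = F (-x) ∧ ‖F (-x)‖ ≤ M * x ^ (-α) := by
  obtain ⟨F, hF, hFK⟩ := h.upper
  refine ⟨F, hF, hFK, fun x hx => ?_⟩
  have hw0 : (-(x : ℂ)) ≠ 0 := by simpa using hx.ne'
  have hcl : (-(x : ℂ)) ∈ closure {z : ℂ | 0 < z.im} := by
    rw [Complex.closure_setOfPred_lt_im]; simp
  have hcw : ContinuousWithinAt F {z : ℂ | 0 < z.im} (-(x : ℂ)) :=
    (hF _ ⟨by simp, hw0⟩).mono fun z (hz : 0 < z.im) =>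
      ⟨hz.le, fun h0 => by rw [mem_singleton_iff] at h0; simp [h0] at hz⟩
  refine ⟨limUnder_eq_of_eqOn hFK hcl hcw, ?_⟩
  simpa [abs_of_pos hx] using
    h.norm_le_of_mem_closure setOf_im_pos_subset_slitPlane hFK hcl hcw hw0

theorem IsSectorial.exists_lower {K : ℂ → E} {M α : ℝ} (h : IsSectorial K M α) :
    ∃ F : ℂ → E, ContinuousOn F ({z | z.im ≤ 0} \ {0}) ∧ EqOn F K {z | z.im < 0} ∧
      ∀ x : ℝ, 0 < x → lowerEdge K x = F (-x) ∧ ‖F (-x)‖ ≤ M * x ^ (-α) := by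
  obtain ⟨F, hF, hFK⟩ := h.lower
  refine ⟨F, hF, hFK, fun x hx => ?_⟩
  have hw0 : (-(x : ℂ)) ≠ 0 := by simpa using hx.ne'
  have hcl : (-(x : ℂ)) ∈ closure {z : ℂ | z.im < 0} := by
    rw [Complex.closure_setOfPred_im_lt]; simp
  have hcw : ContinuousWithinAt F {z : ℂ | z.im < 0} (-(x : ℂ)) :=
    (hF _ ⟨by simp, hw0⟩).mono fun z (hz : z.im < 0) =>
      ⟨hz.le, fun h0 => by rw [mem_singleton_iff] at h0; simp [h0] at hz⟩
  refine ⟨limUnder_eq_of_eqOn hFK hcl hcw, ?_⟩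
  simpa [abs_of_pos hx] using
    h.norm_le_of_mem_closure setOf_im_neg_subset_slitPlane hFK hcl hcw hw0

theorem continuousOn_comp_neg_ofReal {F : ℂ → E} {S : Set ℂ} (hF : ContinuousOn F (S \ {0}))
    (hS : ∀ x : ℝ, -(x : ℂ) ∈ S) : ContinuousOn (fun x : ℝ => F (-x)) (Ioi 0) :=
  hF.comp (by fun_prop) fun x hx => ⟨hS x, by simpa using (ne_of_gt hx)⟩

theorem IsSectorial.continuousOn_upperEdge {K : ℂ → E} {M α : ℝ} (h : IsSectorial K M α) :
    ContinuousOn (upperEdge K) (Ioi 0) := by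
  obtain ⟨F, hF, -, hFe⟩ := h.exists_upper
  exact (continuousOn_comp_neg_ofReal hF (by simp)).congr fun x hx => (hFe x hx).1

theorem IsSectorial.continuousOn_lowerEdge {K : ℂ → E} {M α : ℝ} (h : IsSectorial K M α) :
    ContinuousOn (lowerEdge K) (Ioi 0) := by
  obtain ⟨F, hF, -, hFe⟩ := h.exists_lower
  exact (continuousOn_comp_neg_ofReal hF (by simp)).congr fun x hx => (hFe x hx).1

theorem IsSectorial.norm_upperEdge_le {K : ℂ → E} {M α : ℝ} (h : IsSectorial K M α) {x : ℝ}
    (hx : 0 < x) : ‖upperEdge K x‖ ≤ M * x ^ (-α) := by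
  obtain ⟨F, -, -, hFe⟩ := h.exists_upper
  rw [(hFe x hx).1]; exact (hFe x hx).2

theorem IsSectorial.norm_lowerEdge_le {K : ℂ → E} {M α : ℝ} (h : IsSectorial K M α) {x : ℝ}
    (hx : 0 < x) : ‖lowerEdge K x‖ ≤ M * x ^ (-α) := by
  obtain ⟨F, -, -, hFe⟩ := h.exists_lower
  rw [(hFe x hx).1]; exact (hFe x hx).2

theorem IsSectorial.continuousOn_density {K : ℂ → E} {M α : ℝ} (h : IsSectorial K M α) :
    ContinuousOn (density K) (Ioi 0) :=
  (h.continuousOn_lowerEdge.sub h.continuousOn_upperEdge).const_smul _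

theorem IsSectorial.norm_density_le {K : ℂ → E} {M α : ℝ} (h : IsSectorial K M α) {x : ℝ}
    (hx : 0 < x) : ‖density K x‖ ≤ M * x ^ (-α) := by
  have h1 := h.norm_lowerEdge_le hx
  have h2 := h.norm_upperEdge_le hx
  have h0 : 0 ≤ M * x ^ (-α) := (norm_nonneg _).trans h1
  have hn : ‖(1 / (2 * Real.pi * Complex.I) : ℂ)‖ = 1 / (2 * Real.pi) := by
    simp [abs_of_pos Real.pi_pos]
  rw [density, norm_smul, hn, one_div_mul_eq_div, div_le_iff₀ Real.two_pi_pos]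
  refine (norm_sub_le _ _).trans ?_
  -- The two edges contribute `2 M / (2 π) ≤ M`.
  nlinarith [Real.pi_gt_three]

open Classical in
/-- `K ∘ exp` on the closed strip `|Im s| ≤ π`, with the boundary values of `K` on the edges. -/
noncomputable def stripExt (K : ℂ → E) (s : ℂ) : E :=
  if s.im = Real.pi then upperEdge K (Real.exp s.re)
  else if s.im = -Real.pi then lowerEdge K (Real.exp s.re) else K (Complex.exp s)

theorem stripExt_of_abs_im_lt (K : ℂ → E) {s : ℂ} (hs : |s.im| < Real.pi) :
    stripExt K s = K (Complex.exp s) := by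
  rw [abs_lt] at hs
  rw [stripExt, if_neg hs.2.ne, if_neg hs.1.ne']

theorem stripExt_of_im_eq_pi (K : ℂ → E) {s : ℂ} (hs : s.im = Real.pi) :
    stripExt K s = upperEdge K (Real.exp s.re) := if_pos hs

theorem stripExt_of_im_eq_neg_pi (K : ℂ → E) {s : ℂ} (hs : s.im = -Real.pi) :
    stripExt K s = lowerEdge K (Real.exp s.re) := by
  rw [stripExt, if_neg (by rw [hs]; linarith [Real.pi_pos]), if_pos hs]

theorem IsSectorial.norm_stripExt_le {K : ℂ → E} {M α : ℝ} (h : IsSectorial K M α) {s : ℂ}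
    (hs : |s.im| ≤ Real.pi) : ‖stripExt K s‖ ≤ M * Real.exp s.re ^ (-α) := by
  rcases hs.lt_or_eq with hs | hs
  · rw [stripExt_of_abs_im_lt K hs, ← Complex.norm_exp]
    exact h.norm_le _ (Complex.exp_mem_slitPlane_of_abs_im_lt hs)
  · rcases eq_or_eq_neg_of_abs_eq hs with hs | hs
    · rw [stripExt_of_im_eq_pi K hs]; exact h.norm_upperEdge_le (Real.exp_pos _)
    · rw [stripExt_of_im_eq_neg_pi K hs]; exact h.norm_lowerEdge_le (Real.exp_pos _)

theorem isOpen_abs_im_lt_pi : IsOpen {s : ℂ | |s.im| < Real.pi} :=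
  isOpen_lt (by fun_prop) continuous_const

theorem stripExt_eventuallyEq (K : ℂ → E) {s : ℂ} (hs : |s.im| < Real.pi) :
    stripExt K =ᶠ[𝓝 s] fun s => K (Complex.exp s) :=
  (isOpen_abs_im_lt_pi.eventually_mem hs).mono fun _ hv => stripExt_of_abs_im_lt K hv

theorem IsSectorial.differentiableAt_stripExt {K : ℂ → E} {M α : ℝ} (h : IsSectorial K M α)
    {s : ℂ} (hs : |s.im| < Real.pi) : DifferentiableAt ℂ (stripExt K) s := by
  have h1 : DifferentiableAt ℂ K (Complex.exp s) := h.differentiableOn.differentiableAt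
    (Complex.isOpen_slitPlane.mem_nhds (Complex.exp_mem_slitPlane_of_abs_im_lt hs))
  exact (h1.comp s Complex.differentiableAt_exp).congr_of_eventuallyEq (stripExt_eventuallyEq K hs)

/-- Near the edge `Im s = π` the function is `F ∘ exp`, where `F` extends `K` from the upper half
plane: `exp` maps `0 < Im s ≤ π` into the closed upper half plane without `0`. The other edge is
symmetric. -/
theorem IsSectorial.continuousOn_stripExt {K : ℂ → E} {M α : ℝ} (h : IsSectorial K M α) :
    ContinuousOn (stripExt K) {s | |s.im| ≤ Real.pi} := by
  intro s hs
  rcases (show |s.im| ≤ Real.pi from hs).lt_or_eq with hs' | hs'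
  · exact (h.differentiableAt_stripExt hs').continuousAt.continuousWithinAt
  rcases eq_or_eq_neg_of_abs_eq hs' with hs' | hs'
  · obtain ⟨F, hF, hFK, hFe⟩ := h.exists_upper
    have heq : ∀ v ∈ {s : ℂ | |s.im| ≤ Real.pi} ∩ {s | 0 < s.im},
        0 ≤ (Complex.exp v).im ∧ stripExt K v = F (Complex.exp v) := by
      rintro v ⟨hv : |v.im| ≤ Real.pi, hv0 : 0 < v.im⟩
      rcases (abs_le.1 hv).2.lt_or_eq with hv' | hv'
      · have : 0 < (Complex.exp v).im := by
          rw [Complex.exp_im]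
          exact mul_pos (Real.exp_pos _) (Real.sin_pos_of_pos_of_lt_pi hv0 hv')
        rw [stripExt_of_abs_im_lt K (by rwa [abs_of_pos hv0]), hFK this]
        exact ⟨this.le, rfl⟩
      · rw [stripExt_of_im_eq_pi K hv', Complex.exp_eq_neg_exp_re_of_im_eq (Or.inl hv'),
          (hFe _ (Real.exp_pos _)).1]
        exact ⟨by simp [-Complex.ofReal_exp], rfl⟩
    have hs0 : 0 < s.im := by rw [hs']; exact Real.pi_pos
    rw [← continuousWithinAt_inter ((isOpen_lt continuous_const Complex.continuous_im).mem_nhds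
      hs0)]
    refine ContinuousWithinAt.congr ?_ (fun v hv => (heq v hv).2) (heq s ⟨hs, hs0⟩).2
    exact (hF.comp Complex.continuous_exp.continuousOn
      fun v hv => ⟨(heq v hv).1, Complex.exp_ne_zero v⟩) s ⟨hs, hs0⟩
  · obtain ⟨F, hF, hFK, hFe⟩ := h.exists_lower
    have heq : ∀ v ∈ {s : ℂ | |s.im| ≤ Real.pi} ∩ {s | s.im < 0},
        (Complex.exp v).im ≤ 0 ∧ stripExt K v = F (Complex.exp v) := by
      rintro v ⟨hv : |v.im| ≤ Real.pi, hv0 : v.im < 0⟩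
      rcases (abs_le.1 hv).1.lt_or_eq with hv' | hv'
      · have : (Complex.exp v).im < 0 := by
          rw [Complex.exp_im]
          exact mul_neg_of_pos_of_neg (Real.exp_pos _)
            (Real.sin_neg_of_neg_of_neg_pi_lt hv0 hv')
        rw [stripExt_of_abs_im_lt K (by rw [abs_of_neg hv0]; linarith), hFK this]
        exact ⟨this.le, rfl⟩
      · rw [stripExt_of_im_eq_neg_pi K hv'.symm,
          Complex.exp_eq_neg_exp_re_of_im_eq (Or.inr hv'.symm), (hFe _ (Real.exp_pos _)).1]
        exact ⟨by simp [-Complex.ofReal_exp], rfl⟩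
    have hs0 : s.im < 0 := by rw [hs']; linarith [Real.pi_pos]
    rw [← continuousWithinAt_inter ((isOpen_lt Complex.continuous_im continuous_const).mem_nhds
      hs0)]
    refine ContinuousWithinAt.congr ?_ (fun v hv => (heq v hv).2) (heq s ⟨hs, hs0⟩).2
    exact (hF.comp Complex.continuous_exp.continuousOn
      fun v hv => ⟨(heq v hv).1, Complex.exp_ne_zero v⟩) s ⟨hs, hs0⟩

open Classical in
/-- The Cauchy difference quotient `(K w - K z) / (w - z)` at `z = exp a`, pulled back along
`w = exp s` to the strip `|Im s| ≤ π`. -/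
noncomputable def stripKernel (K : ℂ → E) (a : ℝ) : ℂ → E :=
  Function.update (fun s => (Complex.exp s / (Complex.exp s - Real.exp a)) •
    (stripExt K s - K (Real.exp a))) a (Complex.exp a • deriv K (Real.exp a))

theorem stripKernel_of_ne (K : ℂ → E) {a : ℝ} {s : ℂ} (hs : s ≠ a) :
    stripKernel K a s = (Complex.exp s / (Complex.exp s - Real.exp a)) •
      (stripExt K s - K (Real.exp a)) := Function.update_of_ne hs _ _

theorem IsSectorial.differentiableAt_stripKernel {K : ℂ → E} {M α : ℝ} (h : IsSectorial K M α)
    {a : ℝ} {s : ℂ} (hs : |s.im| < Real.pi) (hsa : s ≠ a) :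
    DifferentiableAt ℂ (stripKernel K a) s := by
  have hne : Complex.exp s - Real.exp a ≠ 0 :=
    sub_ne_zero.2 fun h0 => hsa (Complex.eq_ofReal_of_exp_eq hs.le h0)
  have h1 : DifferentiableAt ℂ (fun s => (Complex.exp s / (Complex.exp s - Real.exp a)) •
      (stripExt K s - K (Real.exp a))) s :=
    (Complex.differentiableAt_exp.div (Complex.differentiableAt_exp.sub_const _) hne).smul
      ((h.differentiableAt_stripExt hs).sub_const _)
  refine h1.congr_of_eventuallyEq ?_
  filter_upwards [isOpen_ne.mem_nhds hsa] with v hv using stripKernel_of_ne K hv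

/-- At `a` the singularity is removable: nearby the kernel is `exp` times the `dslope` of `K`.
Continuity there is enough, since Cauchy's theorem on a rectangle tolerates countably many points
without differentiability. -/
theorem IsSectorial.continuousOn_stripKernel {K : ℂ → E} {M α : ℝ} (h : IsSectorial K M α)
    (a : ℝ) : ContinuousOn (stripKernel K a) {s | |s.im| ≤ Real.pi} := by
  intro s hs
  rcases eq_or_ne s a with rfl | hsa
  · have ha : |(a : ℂ).im| < Real.pi := by simpa using Real.pi_pos
    have hK : DifferentiableAt ℂ K (Complex.exp a) := h.differentiableOn.differentiableAt
      (Complex.isOpen_slitPlane.mem_nhds (Complex.exp_mem_slitPlane_of_abs_im_lt ha))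
    have hc : ContinuousAt (fun s => Complex.exp s • dslope K (Complex.exp a) (Complex.exp s))
        (a : ℂ) :=
      Complex.continuous_exp.continuousAt.smul
        (ContinuousAt.comp (g := dslope K (Complex.exp a)) (continuousAt_dslope_same.2 hK)
          Complex.continuous_exp.continuousAt)
    refine (hc.congr ?_).continuousWithinAt
    filter_upwards [isOpen_abs_im_lt_pi.mem_nhds ha] with v hv
    rcases eq_or_ne v a with rfl | hva
    · simp [stripKernel, dslope_same]
    · have hne : Complex.exp v ≠ Complex.exp a := fun h0 =>
        hva (Complex.eq_ofReal_of_exp_eq (le_of_lt hv) (by rw [h0, Complex.ofReal_exp]))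
      rw [stripKernel_of_ne K hva, dslope_of_ne _ hne, slope_def_module,
        stripExt_of_abs_im_lt K hv, Complex.ofReal_exp, smul_smul, div_eq_mul_inv]
  · have hne : Complex.exp s - Real.exp a ≠ 0 :=
      sub_ne_zero.2 fun h0 => hsa (Complex.eq_ofReal_of_exp_eq hs h0)
    have hq : ContinuousAt (fun s => Complex.exp s / (Complex.exp s - Real.exp a)) s :=
      Complex.continuous_exp.continuousAt.div
        (Complex.continuous_exp.continuousAt.sub continuousAt_const) hne
    have h1 := hq.continuousWithinAt.smul
      ((h.continuousOn_stripExt s hs).sub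
      (continuousWithinAt_const (b := K (Real.exp a))))
    refine h1.congr_of_eventuallyEq ?_ (stripKernel_of_ne K hsa)
    exact mem_nhdsWithin_of_mem_nhds <| by
      filter_upwards [isOpen_ne.mem_nhds hsa] with v hv using stripKernel_of_ne K hv

end GCQ

/-! ### Cauchy's theorem on growing rectangles and the Stieltjes formula. -/

theorem tendsto_intervalIntegral_of_norm_sub_le {E : Type*} [NormedAddCommGroup E]
    [NormedSpace ℝ E] [CompleteSpace E] {a b : ℝ} (hab : a ≤ b) {f : ℝ → ℝ → E} {c : E} {ε : ℝ → ℝ}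
    {l : Filter ℝ} (hf : ∀ᶠ R in l, ContinuousOn (f R) (Icc a b))
    (hε : ∀ᶠ R in l, ∀ y ∈ Icc a b, ‖f R y - c‖ ≤ ε R) (hε0 : Tendsto ε l (𝓝 0)) :
    Tendsto (fun R => ∫ y in a..b, f R y) l (𝓝 ((b - a) • c)) := by
  rw [tendsto_iff_norm_sub_tendsto_zero]
  refine squeeze_zero' (g := fun R => ε R * |b - a|) (Eventually.of_forall fun _ => norm_nonneg _)
    ?_ (by simpa using hε0.mul_const |b - a|)
  filter_upwards [hf, hε] with R hfR hεR
  rw [← intervalIntegral.integral_const, ← intervalIntegral.integral_sub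
    (hfR.intervalIntegrable_of_Icc hab) intervalIntegrable_const]
  refine intervalIntegral.norm_integral_le_of_norm_le_const fun y hy => ?_
  rw [uIoc_of_le hab] at hy
  exact hεR y ⟨hy.1.le, hy.2⟩

theorem tendsto_intervalIntegral_exp {E : Type*} [NormedAddCommGroup E] [NormedSpace ℝ E]
    {g : ℝ → E} (hg : IntegrableOn g (Ioi 0)) :
    Tendsto (fun R : ℝ => ∫ x in Real.exp (-R)..Real.exp R, g x) atTop
      (𝓝 (∫ x in Ioi 0, g x)) := by
  have h1 : Tendsto (fun R : ℝ => Real.exp (-R)) atTop (𝓝 0) :=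
    Real.tendsto_exp_neg_atTop_nhds_zero
  have hcov := (aecover_Ioi_of_Ioi (μ := (volume : Measure ℝ)) h1).inter
    (aecover_Iic (μ := volume.restrict (Ioi (0 : ℝ))) Real.tendsto_exp_atTop)
  refine (hcov.integral_tendsto_of_countably_generated hg).congr' ?_
  filter_upwards [eventually_ge_atTop (0 : ℝ)] with R hR
  have hsub : Ioc (Real.exp (-R)) (Real.exp R) ⊆ Ioi 0 := fun x hx =>
    (Real.exp_pos _).trans hx.1
  rw [Ioi_inter_Iic, Measure.restrict_restrict measurableSet_Ioc, inter_eq_left.2 hsub,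
    intervalIntegral.integral_of_le (Real.exp_le_exp.2 (by linarith))]

namespace GCQ

variable {E : Type*} [NormedAddCommGroup E] [NormedSpace ℂ E]

theorem stripKernel_of_im (K : ℂ → E) {a : ℝ} {s : ℂ}
    (hs : s.im = Real.pi ∨ s.im = -Real.pi) :
    stripKernel K a s = (Real.exp s.re / (Real.exp s.re + Real.exp a)) •
      (stripExt K s - K (Real.exp a)) := by
  have hsa : s ≠ a := by
    rintro rfl
    rcases hs with h | h <;> simp [Real.pi_ne_zero.symm] at h
  have h0 : ((Real.exp s.re + Real.exp a : ℝ) : ℂ) ≠ 0 := by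
    exact_mod_cast (add_pos (Real.exp_pos _) (Real.exp_pos _)).ne'
  rw [stripKernel_of_ne K hsa, Complex.exp_eq_neg_exp_re_of_im_eq hs, ← Complex.coe_smul]
  congr 1
  rw [Complex.ofReal_div, ← neg_add', neg_div_neg_eq, Complex.ofReal_add]

/-- On the far right the kernel tends to `-K (exp a)`: its scalar factor is `1 + p` with `p → 0`,
while `K` decays because `α > 0`. This side supplies the value of `K` in the Stieltjes formula. -/
theorem IsSectorial.norm_stripKernel_add_le {K : ℂ → E} {M α : ℝ} (h : IsSectorial K M α)
    {a : ℝ} {s : ℂ} (hs : |s.im| ≤ Real.pi) (ha : a < s.re) :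
    ‖stripKernel K a s + K (Real.exp a)‖ ≤
      (1 + Real.exp a / (Real.exp s.re - Real.exp a)) * (M * Real.exp s.re ^ (-α)) +
        Real.exp a / (Real.exp s.re - Real.exp a) * ‖K (Real.exp a)‖ := by
  have hsa : s ≠ a := by rintro rfl; simp at ha
  have hd : 0 < Real.exp s.re - Real.exp a := sub_pos.2 (Real.exp_lt_exp.2 ha)
  have hle : Real.exp s.re - Real.exp a ≤ ‖Complex.exp s - Real.exp a‖ := by
    have := norm_sub_norm_le (Complex.exp s) (Real.exp a : ℂ)
    rwa [Complex.norm_exp, Complex.norm_real, Real.norm_of_nonneg (Real.exp_pos a).le] at this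
  have hne : Complex.exp s - Real.exp a ≠ 0 := norm_pos_iff.1 (hd.trans_le hle)
  set p : ℂ := Real.exp a / (Complex.exp s - Real.exp a) with hp
  have hpn : ‖p‖ ≤ Real.exp a / (Real.exp s.re - Real.exp a) := by
    rw [hp, norm_div, Complex.norm_real, Real.norm_of_nonneg (Real.exp_pos a).le]
    gcongr
  have hq : Complex.exp s / (Complex.exp s - Real.exp a) = 1 + p := by
    rw [hp]; field_simp; ring
  have e : stripKernel K a s + K (Real.exp a) = (1 + p) • stripExt K s - p • K (Real.exp a) := by
    rw [stripKernel_of_ne K hsa, hq, smul_sub, add_smul 1 p (K _), one_smul]; abel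
  have hΦ := h.norm_stripExt_le hs
  rw [e]
  refine (norm_sub_le _ _).trans ?_
  rw [norm_smul, norm_smul]
  gcongr
  exact (norm_add_le _ _).trans (by simpa using hpn)

/-- On the far left the scalar factor `exp s` beats the blow-up of `K` at `0` because `α < 1`, so
this side disappears in the limit. -/
theorem IsSectorial.norm_stripKernel_le {K : ℂ → E} {M α : ℝ} (h : IsSectorial K M α)
    {a : ℝ} {s : ℂ} (hs : |s.im| ≤ Real.pi) (ha : s.re < a) :
    ‖stripKernel K a s‖ ≤
      (M * Real.exp s.re ^ (1 - α) + Real.exp s.re * ‖K (Real.exp a)‖) /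
        (Real.exp a - Real.exp s.re) := by
  have hsa : s ≠ a := by rintro rfl; simp at ha
  have hd : 0 < Real.exp a - Real.exp s.re := sub_pos.2 (Real.exp_lt_exp.2 ha)
  have hle : Real.exp a - Real.exp s.re ≤ ‖Complex.exp s - Real.exp a‖ := by
    have := norm_sub_norm_le (Real.exp a : ℂ) (Complex.exp s)
    rwa [Complex.norm_exp, Complex.norm_real, Real.norm_of_nonneg (Real.exp_pos a).le,
      norm_sub_rev] at this
  have hΦ := h.norm_stripExt_le hs
  rw [stripKernel_of_ne K hsa, norm_smul, norm_div, Complex.norm_exp]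
  calc _ ≤ Real.exp s.re / (Real.exp a - Real.exp s.re) *
        (M * Real.exp s.re ^ (-α) + ‖K (Real.exp a)‖) := by
        gcongr
        exact (norm_sub_le _ _).trans (by gcongr)
    _ = _ := by
        rw [show (1 : ℝ) - α = -α + 1 by ring, Real.rpow_add_one (Real.exp_pos _).ne']; ring

theorem integrableOn_inv_add_smul {α z : ℝ}
    (hα0 : 0 < α) (hα1 : α < 1) (hz : 0 < z) {g : ℝ → E} (hg : ContinuousOn g (Ioi 0)) {C : ℝ}
    (hgn : ∀ x : ℝ, 0 < x → ‖g x‖ ≤ C * x ^ (-α)) :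
    IntegrableOn (fun x : ℝ => (x + z)⁻¹ • g x) (Ioi 0) := by
  have hi := (integrableOn_rpow_neg_div_one_add_mul hα0 hα1 (inv_pos.2 hz)).const_mul (C * z⁻¹)
  refine hi.mono' ?_ ?_
  · exact (by fun_prop : Measurable fun x : ℝ => (x + z)⁻¹).aestronglyMeasurable.smul
      (hg.aestronglyMeasurable measurableSet_Ioi)
  · refine (ae_restrict_iff' measurableSet_Ioi).2 (Eventually.of_forall fun x hx => ?_)
    have hx0 : 0 < x := hx
    rw [norm_smul, Real.norm_of_nonneg (by positivity)]
    calc _ ≤ (x + z)⁻¹ * (C * x ^ (-α)) := by gcongr; exact hgn x hx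
      _ = _ := by field_simp; ring

/-- In the variable `s = log w` the keyhole contour around the cut is the rectangle `[-R, R] × [-π,
π]`. On both horizontal sides `exp s = -exp u`, so the scalar factors agree, the constant `K (exp
a)` cancels, and `x = exp u` leaves the jump of `K`. -/
theorem IsSectorial.rectangle_identity [CompleteSpace E] {K : ℂ → E} {M α : ℝ}
    (h : IsSectorial K M α) (a R : ℝ) :
    (∫ x in Real.exp (-R)..Real.exp R,
        (x + Real.exp a)⁻¹ • (lowerEdge K x - upperEdge K x)) +
      Complex.I • (∫ y in (-Real.pi)..Real.pi, stripKernel K a (R + y * Complex.I)) -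
      Complex.I • (∫ y in (-Real.pi)..Real.pi, stripKernel K a ((-R : ℝ) + y * Complex.I)) = 0 := by
  have hpi := Real.pi_pos
  have hrect := Complex.integral_boundary_rect_eq_zero_of_differentiable_on_off_countable
    (stripKernel K a) ⟨-R, -Real.pi⟩ ⟨R, Real.pi⟩ {(a : ℂ)} (countable_singleton _)
    ((h.continuousOn_stripKernel a).mono fun s hs => by
      have := hs.2
      rw [uIcc_of_le (by linarith)] at this
      exact abs_le.2 this)
    (fun s hs => h.differentiableAt_stripKernel (by
      have := hs.1.2
      rw [min_eq_left (by linarith), max_eq_right (by linarith)] at this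
      exact abs_lt.2 this) hs.2)
  simp only at hrect
  rw [← hrect]
  congr 2
  have hc : ∀ p : ℝ, |p| ≤ Real.pi →
      IntervalIntegrable (fun x : ℝ => stripKernel K a (x + p * Complex.I)) volume (-R) R :=
    fun p hp => ContinuousOn.intervalIntegrable <|
      (h.continuousOn_stripKernel a).comp (by fun_prop) fun x _ => by simpa using hp
  rw [← intervalIntegral.integral_sub (hc _ (by simp [abs_of_pos hpi]))
    (hc _ (by simp [abs_of_pos hpi])),
    ← intervalIntegral.integral_deriv_smul_comp_of_deriv_nonneg (f := Real.exp) (f' := Real.exp)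
      Real.continuous_exp.continuousOn (fun x _ => Real.hasDerivAt_exp x)
      (fun x _ => (Real.exp_pos x).le)]
  refine intervalIntegral.integral_congr fun u _ => ?_
  rw [stripKernel_of_im K (by simp), stripKernel_of_im K (by simp),
    stripExt_of_im_eq_neg_pi K (by simp), stripExt_of_im_eq_pi K (by simp)]
  simp only [Complex.add_re, Complex.ofReal_re, Complex.mul_re, Complex.I_re, mul_zero,
    Complex.ofReal_im, Complex.I_im, mul_one, sub_self, add_zero, Function.comp_apply]
  rw [← smul_sub, sub_sub_sub_cancel_right, smul_smul, div_eq_mul_inv]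

/-- The Stieltjes representation `K z = ∫₀^∞ G x / (x + z) dx` for `z > 0`. -/
theorem IsSectorial.integral_inv_add_smul_density [CompleteSpace E] {K : ℂ → E} {M α z : ℝ}
    (h : IsSectorial K M α) (hα0 : 0 < α) (hα1 : α < 1) (hz : 0 < z) :
    ∫ x in Ioi (0 : ℝ), (x + z)⁻¹ • density K x = K z := by
  obtain ⟨a, rfl⟩ : ∃ a, Real.exp a = z := ⟨Real.log z, Real.exp_log hz⟩
  have hpi := Real.pi_pos
  have hstrip : ∀ (R : ℝ), ContinuousOn (fun y : ℝ => stripKernel K a (R + y * Complex.I))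
      (Icc (-Real.pi) Real.pi) := fun R =>
    (h.continuousOn_stripKernel a).comp (by fun_prop) fun y hy => by simpa using abs_le.2 hy
  have hint : IntegrableOn (fun x : ℝ =>
      (x + Real.exp a)⁻¹ • (lowerEdge K x - upperEdge K x)) (Ioi 0) :=
    integrableOn_inv_add_smul hα0 hα1 (Real.exp_pos a)
      (h.continuousOn_lowerEdge.sub h.continuousOn_upperEdge) (C := M + M) fun x hx =>
        (norm_sub_le _ _).trans (by
          rw [add_mul]; exact add_le_add (h.norm_lowerEdge_le hx) (h.norm_upperEdge_le hx))
  have hright : Tendsto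
      (fun R : ℝ => ∫ y in (-Real.pi)..Real.pi, stripKernel K a (R + y * Complex.I)) atTop
      (𝓝 ((Real.pi - -Real.pi) • -K (Real.exp a))) := by
    refine tendsto_intervalIntegral_of_norm_sub_le (by linarith) (Eventually.of_forall hstrip)
      (ε := fun R => (1 + Real.exp a / (Real.exp R - Real.exp a)) * (M * Real.exp R ^ (-α)) +
        Real.exp a / (Real.exp R - Real.exp a) * ‖K (Real.exp a)‖) ?_ ?_
    · filter_upwards [eventually_gt_atTop a] with R hR y hy
      have := h.norm_stripKernel_add_le (a := a) (s := R + y * Complex.I)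
        (by simpa using abs_le.2 hy) (by simpa using hR)
      rw [sub_neg_eq_add]
      simpa using this
    · have h1 : Tendsto (fun R => Real.exp a / (Real.exp R - Real.exp a)) atTop (𝓝 0) :=
        tendsto_const_nhds.div_atTop
          (tendsto_atTop_add_const_right _ (-Real.exp a) Real.tendsto_exp_atTop)
      have h2 : Tendsto (fun R => Real.exp R ^ (-α)) atTop (𝓝 0) :=
        (tendsto_rpow_neg_atTop hα0).comp Real.tendsto_exp_atTop
      simpa using ((h1.const_add 1).mul (h2.const_mul M)).add (h1.mul_const ‖K (Real.exp a)‖)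
  have hleft : Tendsto
      (fun R : ℝ => ∫ y in (-Real.pi)..Real.pi, stripKernel K a ((-R : ℝ) + y * Complex.I)) atTop
      (𝓝 ((Real.pi - -Real.pi) • (0 : E))) := by
    refine tendsto_intervalIntegral_of_norm_sub_le (by linarith)
      (Eventually.of_forall fun R => hstrip (-R))
      (ε := fun R => (M * Real.exp (-R) ^ (1 - α) + Real.exp (-R) * ‖K (Real.exp a)‖) /
        (Real.exp a - Real.exp (-R))) ?_ ?_
    · filter_upwards [eventually_gt_atTop (-a)] with R hR y hy
      have := h.norm_stripKernel_le (a := a) (s := (-R : ℝ) + y * Complex.I)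
        (by simpa using abs_le.2 hy) (by simp; linarith)
      simpa using this
    · have h1 : Tendsto (fun R : ℝ => Real.exp (-R)) atTop (𝓝 0) :=
        Real.tendsto_exp_neg_atTop_nhds_zero
      have h2 : Tendsto (fun R : ℝ => Real.exp (-R) ^ (1 - α)) atTop (𝓝 0) := by
        have := h1.rpow_const (p := 1 - α) (Or.inr (by linarith))
        rwa [Real.zero_rpow (by linarith)] at this
      have h3 := ((h2.const_mul M).add (h1.mul_const ‖K (Real.exp a)‖)).div
        (h1.const_sub (Real.exp a)) (by simp)
      simpa [Pi.div_def] using h3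
  have hlim := ((tendsto_intervalIntegral_exp hint).add (hright.const_smul Complex.I)).sub
    (hleft.const_smul Complex.I)
  have hzero := tendsto_nhds_unique hlim (tendsto_const_nhds.congr fun R =>
    (h.rectangle_identity a R).symm)
  have hL : ∫ x in Ioi (0 : ℝ), (x + Real.exp a)⁻¹ • (lowerEdge K x - upperEdge K x) =
      (2 * Real.pi * Complex.I : ℂ) • K (Real.exp a) := by
    rw [smul_zero, smul_zero, sub_zero, add_eq_zero_iff_eq_neg] at hzero
    rw [hzero, smul_neg, smul_neg, neg_neg, ← Complex.coe_smul, smul_smul]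
    congr 1
    push_cast; ring
  have h2pi : (2 * Real.pi * Complex.I : ℂ) ≠ 0 := by simp [hpi.ne']
  simp only [density, smul_comm _ (1 / (2 * Real.pi * Complex.I) : ℂ)]
  rw [integral_smul, hL, smul_smul, one_div_mul_cancel h2pi, one_smul]

end GCQ

/-! ### Injectivity of the Laplace transform, and Fubini. -/

/-- With `u = exp (-t)` the hypothesis says that `g` annihilates polynomials in `u`. The test
function becomes `ψ (-log u)`, continuous on `[0, 1]`, and Weierstrass approximation concludes. -/
theorem integral_smul_eq_zero_of_moments {E : Type*} [NormedAddCommGroup E] [NormedSpace ℝ E]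
    {g : ℝ → E} (hg : IntegrableOn g (Ioi 0))
    (h0 : ∀ m : ℕ, ∫ t in Ioi (0 : ℝ), Real.exp (-t) ^ m • g t = 0)
    {ψ : ℝ → ℝ} (hψ : Continuous ψ) (hψc : HasCompactSupport ψ) (hψ0 : tsupport ψ ⊆ Ioi 0) :
    ∫ t in Ioi (0 : ℝ), ψ t • g t = 0 := by
  have hexp : ∀ t ∈ Ioi (0 : ℝ), Real.exp (-t) ∈ Icc (0 : ℝ) 1 := fun t ht =>
    ⟨(Real.exp_pos _).le, Real.exp_le_one_iff.2 (by simpa using le_of_lt ht)⟩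
  have hbdd : ∀ φ : ℝ → ℝ, Continuous φ → ∀ C : ℝ, (∀ t ∈ Ioi (0 : ℝ), |φ t| ≤ C) →
      IntegrableOn (fun t => φ t • g t) (Ioi 0) := fun φ hφ C hC =>
    Integrable.bdd_smul hg C hφ.aestronglyMeasurable
      ((ae_restrict_iff' measurableSet_Ioi).2 (Eventually.of_forall hC))
  have hpow : ∀ m : ℕ, IntegrableOn (fun t => Real.exp (-t) ^ m • g t) (Ioi 0) := fun m =>
    hbdd (fun t => Real.exp (-t) ^ m) (by fun_prop) 1 fun t ht => by
      rw [abs_of_nonneg (by positivity)]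
      exact pow_le_one₀ (hexp t ht).1 (hexp t ht).2
  have hpoly : ∀ p : Polynomial ℝ,
      IntegrableOn (fun t => p.eval (Real.exp (-t)) • g t) (Ioi 0) ∧
      ∫ t in Ioi (0 : ℝ), p.eval (Real.exp (-t)) • g t = 0 := fun p => by
    have e : ∀ t, p.eval (Real.exp (-t)) • g t = ∑ i ∈ Finset.range (p.natDegree + 1),
        p.coeff i • (Real.exp (-t) ^ i • g t) := fun t => by
      rw [Polynomial.eval_eq_sum_range, Finset.sum_smul]
      simp only [mul_smul]
    have hi : ∀ i ∈ Finset.range (p.natDegree + 1),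
        IntegrableOn (fun t => p.coeff i • (Real.exp (-t) ^ i • g t)) (Ioi 0) := fun i _ =>
      Integrable.smul (p.coeff i) (hpow i)
    simp only [e]
    refine ⟨integrable_finsetSum _ hi, ?_⟩
    rw [integral_finsetSum _ hi]
    simp [integral_smul, h0]
  obtain ⟨C, hC⟩ := hψ.bounded_above_of_compact_support hψc
  obtain ⟨B, hB⟩ := hψc.isCompact.isBounded.subset_closedBall 0
  have hφ : ContinuousOn (fun u : ℝ => ψ (-Real.log u)) (Icc 0 1) := by
    intro u hu
    rcases hu.1.eq_or_lt with rfl | hu0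
    · have hz : ∀ v : ℝ, 0 ≤ v → v < Real.exp (-B) → ψ (-Real.log v) = 0 := fun v hv0 hv => by
        refine image_eq_zero_of_notMem_tsupport fun hmem => ?_
        rcases hv0.eq_or_lt with rfl | hv0
        -- At `v = 0` the default `Real.log 0 = 0` gives the argument `0`, which lies outside the
        -- support of `ψ`.
        · simpa using hψ0 hmem
        · have h1 : |(-Real.log v)| ≤ B := by simpa using hB hmem
          have h2 := (Real.log_lt_iff_lt_exp hv0).2 hv
          linarith [le_abs_self (-Real.log v)]
      have he : (fun u : ℝ => ψ (-Real.log u)) =ᶠ[𝓝[Icc 0 1] 0] fun _ => 0 := by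
        filter_upwards [self_mem_nhdsWithin,
          mem_nhdsWithin_of_mem_nhds (Iio_mem_nhds (Real.exp_pos (-B)))] with v hv hv'
        exact hz v hv.1 hv'
      exact continuousWithinAt_const.congr_of_eventuallyEq he (hz 0 le_rfl (Real.exp_pos _))
    · exact (hψ.continuousAt.comp (Real.continuousAt_log hu0.ne').neg).continuousWithinAt
  by_contra hne
  set I := ∫ t in Ioi (0 : ℝ), ‖g t‖
  have hI : 0 ≤ I := integral_nonneg fun _ => norm_nonneg _
  have hpos : 0 < ‖∫ t in Ioi (0 : ℝ), ψ t • g t‖ := norm_pos_iff.2 hne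
  obtain ⟨p, hp⟩ := exists_polynomial_near_of_continuousOn 0 1 _ hφ
    (‖∫ t in Ioi (0 : ℝ), ψ t • g t‖ / (I + 1)) (by positivity)
  set ε := ‖∫ t in Ioi (0 : ℝ), ψ t • g t‖ / (I + 1) with hε
  have hle : ‖∫ t in Ioi (0 : ℝ), ψ t • g t‖ ≤ ε * I := by
    have hψi := hbdd ψ hψ C fun t _ => hC t
    rw [← sub_zero (∫ t in Ioi (0 : ℝ), ψ t • g t), ← (hpoly p).2, ← integral_sub hψi (hpoly p).1,
      ← integral_const_mul]
    refine norm_integral_le_of_norm_le (hg.norm.const_mul ε)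
      ((ae_restrict_iff' measurableSet_Ioi).2 (Eventually.of_forall fun t ht => ?_))
    rw [← sub_smul, norm_smul, norm_sub_rev]
    have := hp _ (hexp t ht)
    rw [Real.log_exp, neg_neg] at this
    gcongr
    exact this.le
  rw [hε, div_mul_eq_mul_div, le_div_iff₀ (by positivity)] at hle
  nlinarith

/-- Injectivity of the Laplace transform. -/
theorem ae_eq_zero_of_laplace_eq_zero {E : Type*} [NormedAddCommGroup E] [NormedSpace ℝ E]
    [CompleteSpace E] {h : ℝ → E} {σ : ℝ}
    (hi : ∀ z : ℝ, σ < z → IntegrableOn (fun t : ℝ => Real.exp (-z * t) • h t) (Ioi 0))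
    (h0 : ∀ z : ℝ, σ < z → ∫ t in Ioi (0 : ℝ), Real.exp (-z * t) • h t = 0) :
    ∀ᵐ t : ℝ, t ∈ Ioi (0 : ℝ) → h t = 0 := by
  -- The weighted function `exp (-(σ + 1) t) h t` is integrable, and its `m`-th moment in `exp (-t)`
  -- is the transform of `h` at `σ + 1 + m`.
  have hg := hi (σ + 1) (by linarith)
  have key := isOpen_Ioi.ae_eq_zero_of_integral_contDiff_smul_eq_zero
    hg.locallyIntegrableOn fun ψ hψ hψc hψ0 => by
      rw [← setIntegral_eq_integral_of_forall_compl_eq_zero (s := Ioi 0) fun t ht => by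
        rw [image_eq_zero_of_notMem_tsupport fun hm => ht (hψ0 hm), zero_smul]]
      refine integral_smul_eq_zero_of_moments hg (fun m => ?_) hψ.continuous hψc hψ0
      rw [← h0 (σ + 1 + m) (by linarith [m.cast_nonneg (α := ℝ)])]
      congr 1; funext t
      rw [smul_smul, ← Real.exp_nat_mul, ← Real.exp_add]
      congr 2; ring
  filter_upwards [key] with t ht ht0
  exact (smul_eq_zero.1 (ht ht0)).resolve_left (Real.exp_pos _).ne'

/-- Fubini for `w t • exp (- t x) • G x` on `S × (0, ∞)`. -/
theorem integral_smul_laplace {E : Type*} [NormedAddCommGroup E] [NormedSpace ℝ E]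
    [CompleteSpace E] {α C : ℝ} {S : Set ℝ} (hS : MeasurableSet S) {w V : ℝ → ℝ} {G : ℝ → E}
    (hw : Measurable w) (hw0 : ∀ t ∈ S, 0 ≤ w t)
    (hwi : ∀ x : ℝ, 0 < x → IntegrableOn (fun t => w t * Real.exp (-t * x)) S)
    (hV : ∀ x : ℝ, 0 < x → ∫ t in S, w t * Real.exp (-t * x) ≤ V x)
    (hVi : IntegrableOn (fun x => V x * x ^ (-α)) (Ioi 0))
    (hG : ContinuousOn G (Ioi 0)) (hGn : ∀ x : ℝ, 0 < x → ‖G x‖ ≤ C * x ^ (-α)) :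
    IntegrableOn (fun t => w t • ∫ x in Ioi (0 : ℝ), Real.exp (-t * x) • G x) S ∧
    IntegrableOn (fun x => (∫ t in S, w t * Real.exp (-t * x)) • G x) (Ioi 0) ∧
    ∫ t in S, w t • ∫ x in Ioi (0 : ℝ), Real.exp (-t * x) • G x =
      ∫ x in Ioi (0 : ℝ), (∫ t in S, w t * Real.exp (-t * x)) • G x := by
  set F : ℝ × ℝ → E := fun p => (w p.1 * Real.exp (-p.1 * p.2)) • G p.2 with hF
  have hFm : AEStronglyMeasurable F ((volume.restrict S).prod (volume.restrict (Ioi 0))) :=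
    (by fun_prop : Measurable fun p : ℝ × ℝ =>
      w p.1 * Real.exp (-p.1 * p.2)).aestronglyMeasurable.smul
      (hG.aestronglyMeasurable measurableSet_Ioi).comp_snd
  have hnorm : ∀ x : ℝ, ∫ t in S, ‖F (t, x)‖ =
      (∫ t in S, w t * Real.exp (-t * x)) * ‖G x‖ := fun x => by
    rw [← integral_mul_const]
    refine setIntegral_congr_fun hS fun t ht => ?_
    have := hw0 t ht
    simp only [hF]
    rw [norm_smul, Real.norm_of_nonneg (by positivity)]
  have hW0 : ∀ x : ℝ, 0 ≤ ∫ t in S, w t * Real.exp (-t * x) := fun x =>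
    setIntegral_nonneg hS fun t ht => mul_nonneg (hw0 t ht) (Real.exp_pos _).le
  have hFi : Integrable F ((volume.restrict S).prod (volume.restrict (Ioi 0))) := by
    refine (integrable_prod_iff' hFm).2 ⟨(ae_restrict_iff' measurableSet_Ioi).2
      (Eventually.of_forall fun x hx => (hwi x hx).smul_const (G x)), ?_⟩
    refine Integrable.mono' (hVi.const_mul C) hFm.norm.prod_swap.integral_prod_right' ?_
    refine (ae_restrict_iff' measurableSet_Ioi).2 (Eventually.of_forall fun x hx => ?_)
    rw [hnorm, Real.norm_of_nonneg (mul_nonneg (hW0 x) (norm_nonneg _))]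
    calc _ ≤ V x * (C * x ^ (-α)) :=
          mul_le_mul (hV x hx) (hGn x hx) (norm_nonneg _) ((hW0 x).trans (hV x hx))
      _ = _ := by ring
  have e1 : ∀ t, w t • ∫ x in Ioi (0 : ℝ), Real.exp (-t * x) • G x =
      ∫ x in Ioi (0 : ℝ), F (t, x) := fun t => by
    rw [← integral_smul]; simp only [hF, mul_smul]
  have e2 : ∀ x, (∫ t in S, w t * Real.exp (-t * x)) • G x = ∫ t in S, F (t, x) := fun x => by
    rw [← integral_smul_const]
  simp only [e1, e2]
  exact ⟨hFi.integral_prod_left, hFi.integral_prod_right, integral_integral_swap hFi⟩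

/-! ### The kernel, the convolution and the quadrature as integrals against `G`. -/

namespace GCQ

variable {E : Type*} [NormedAddCommGroup E] [NormedSpace ℂ E]

theorem IsSectorial.laplace_density [CompleteSpace E] {K : ℂ → E} {M α z : ℝ}
    (h : IsSectorial K M α) (hα0 : 0 < α) (hα1 : α < 1) (hz : 0 < z) :
    IntegrableOn (fun t : ℝ => Real.exp (-z * t) •
      ∫ x in Ioi (0 : ℝ), Real.exp (-t * x) • density K x) (Ioi 0) ∧
    ∫ t in Ioi (0 : ℝ), Real.exp (-z * t) •
      ∫ x in Ioi (0 : ℝ), Real.exp (-t * x) • density K x = K z := by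
  have e : ∀ x t : ℝ, Real.exp (-z * t) * Real.exp (-t * x) = Real.exp (-(x + z) * t) :=
    fun x t => by rw [← Real.exp_add]; congr 1; ring
  have hint : ∀ x : ℝ, 0 < x →
      ∫ t in Ioi (0 : ℝ), Real.exp (-z * t) * Real.exp (-t * x) = (x + z)⁻¹ := fun x hx => by
    simp only [e]
    rw [integral_exp_mul_Ioi (by linarith)]
    simp [neg_div_neg_eq, -neg_add_rev]
  have hi := (integrableOn_rpow_neg_div_one_add_mul hα0 hα1 (inv_pos.2 hz)).const_mul z⁻¹
  have key := integral_smul_laplace (α := α) (C := M) (w := fun t => Real.exp (-z * t))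
    (V := fun x => (x + z)⁻¹) measurableSet_Ioi (by fun_prop) (fun t _ => (Real.exp_pos _).le)
    (fun x hx => by
      simp only [e]; exact integrableOn_exp_mul_Ioi (by linarith) 0)
    (fun x hx => (hint x hx).le)
    (IntegrableOn.congr_fun hi (fun x hx => by
      have : 0 < x := hx
      field_simp; ring) measurableSet_Ioi)
    h.continuousOn_density (fun x hx => h.norm_density_le hx)
  refine ⟨key.1, ?_⟩
  rw [key.2.2, ← h.integral_inv_add_smul_density hα0 hα1 hz]
  exact setIntegral_congr_fun measurableSet_Ioi fun x hx => by rw [hint x hx]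

/-- The kernel `k` is the Laplace transform of the density `G`. -/
theorem IsSectorial.ae_eq_integral_density [CompleteSpace E] {K : ℂ → E} {k : ℝ → E} {M α : ℝ}
    (h : IsSectorial K M α) (hk : IsLaplaceTransform k K) (hα0 : 0 < α) (hα1 : α < 1) :
    ∀ᵐ t : ℝ, t ∈ Ioi (0 : ℝ) →
      k t = ∫ x in Ioi (0 : ℝ), Real.exp (-t * x) • density K x := by
  obtain ⟨σ, hσ⟩ := hk
  -- Real `z` suffice for injectivity; `z > 0` is needed for the transform built from `G`, `z > σ`
  -- for that of `k`.
  have hk' : ∀ z : ℝ, max σ 0 < z →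
      IntegrableOn (fun t : ℝ => Real.exp (-z * t) • k t) (Ioi 0) ∧
      ∫ t in Ioi (0 : ℝ), Real.exp (-z * t) • k t = K z := fun z hz => by
    have e : ∀ t : ℝ, Complex.exp (-(z : ℂ) * t) • k t = Real.exp (-z * t) • k t := fun t => by
      rw [← Complex.coe_smul]; push_cast; rfl
    simpa only [e] using hσ z (by simpa using (max_lt_iff.1 hz).1)
  have key := ae_eq_zero_of_laplace_eq_zero (σ := max σ 0)
    (h := fun t => k t - ∫ x in Ioi (0 : ℝ), Real.exp (-t * x) • density K x)
    (fun z hz => by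
      simp only [smul_sub]
      exact (hk' z hz).1.sub (h.laplace_density hα0 hα1 (max_lt_iff.1 hz).2).1)
    (fun z hz => by
      simp only [smul_sub]
      rw [integral_sub (hk' z hz).1 (h.laplace_density hα0 hα1 (max_lt_iff.1 hz).2).1,
        (hk' z hz).2, (h.laplace_density hα0 hα1 (max_lt_iff.1 hz).2).2, sub_self])
  filter_upwards [key] with t ht ht0 using sub_eq_zero.1 (ht ht0)

theorem intervalIntegral_rpow_mul_exp_eq_exactSol (β x T : ℝ) :
    ∫ t in (0 : ℝ)..T, (T - t) ^ β * Real.exp (-t * x) = exactSol β x T := by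
  have h := intervalIntegral.integral_comp_sub_left (a := 0) (b := T)
    (fun r => Real.exp (-x * (T - r)) * r ^ β) T
  rw [sub_self, sub_zero] at h
  rw [exactSol, ← h]
  congr 1; funext t
  rw [mul_comm]; congr 2; ring

/-- Fubini with weight `(T - t) ^ β`: the inner integral over `t` is the exact scalar solution at
`T`, whose decay `1 / (1 + T x)` makes it integrable against `x ^ (-α)`. -/
theorem IsSectorial.convolution_eq [CompleteSpace E] {K : ℂ → E} {k : ℝ → E} {M α β T : ℝ}
    (h : IsSectorial K M α) (hk : IsLaplaceTransform k K) (hα0 : 0 < α) (hα1 : α < 1)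
    (hβ : -1 < β) (hT : 0 < T) :
    IntervalIntegrable (fun s : ℝ => s ^ β • k (T - s)) volume 0 T ∧
    IntegrableOn (fun x => exactSol β x T • density K x) (Ioi 0) ∧
    convolution k (fun s => s ^ β) T =
      ∫ x in Ioi (0 : ℝ), exactSol β x T • density K x := by
  obtain ⟨C, hC, hCb⟩ := exists_exactSol_le hβ
  have hW : ∀ x : ℝ, ∫ t in Ioc 0 T, (T - t) ^ β * Real.exp (-t * x) = exactSol β x T :=
    fun x => by
      rw [← intervalIntegral.integral_of_le hT.le, intervalIntegral_rpow_mul_exp_eq_exactSol]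
  have hwi : ∀ x : ℝ, IntegrableOn (fun t => (T - t) ^ β * Real.exp (-t * x)) (Ioc 0 T) :=
    fun x => by
      have h1 : IntervalIntegrable (fun t : ℝ => (T - t) ^ β) volume (T - 0) (T - T) :=
        (intervalIntegral.intervalIntegrable_rpow' hβ (a := 0) (b := T)).comp_sub_left T
      rw [sub_zero, sub_self] at h1
      exact (intervalIntegrable_iff_integrableOn_Ioc_of_le hT.le).1
        (h1.symm.mul_continuousOn (Continuous.continuousOn (by fun_prop)))
  obtain ⟨h1, h2, h3⟩ := integral_smul_laplace (α := α) (C := M) (w := fun t => (T - t) ^ β)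
    (V := fun x => C * T ^ (β + 1) / (1 + T * x)) (S := Ioc 0 T) measurableSet_Ioc
    (by fun_prop) (fun t ht => Real.rpow_nonneg (sub_nonneg.2 ht.2) _) (fun x _ => hwi x)
    (fun x hx => by rw [hW]; exact hCb x T (le_of_lt hx) hT)
    (IntegrableOn.congr_fun
      ((integrableOn_rpow_neg_div_one_add_mul hα0 hα1 hT).const_mul (C * T ^ (β + 1)))
      (fun x _ => by ring) measurableSet_Ioi)
    h.continuousOn_density (fun x hx => h.norm_density_le hx)
  simp only [hW] at h2 h3
  have hae : (fun t => (T - t) ^ β • k t) =ᵐ[volume.restrict (Ioc 0 T)] fun t =>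
      (T - t) ^ β • ∫ x in Ioi (0 : ℝ), Real.exp (-t * x) • density K x := by
    refine (ae_restrict_iff' measurableSet_Ioc).2 ?_
    filter_upwards [h.ae_eq_integral_density hk hα0 hα1] with t ht ht0
    rw [ht ht0.1]
  have hint : IntervalIntegrable (fun t => (T - t) ^ β • k t) volume 0 T :=
    (intervalIntegrable_iff_integrableOn_Ioc_of_le hT.le).2 (h1.congr hae.symm)
  refine ⟨?_, h2, ?_⟩
  · have := (hint.comp_sub_left T).symm
    simpa using this
  · rw [← h3, ← integral_congr_ae hae, ← intervalIntegral.integral_of_le hT.le, convolution]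
    have := intervalIntegral.integral_comp_sub_left (a := 0) (b := T)
      (fun t => (T - t) ^ β • k t) T
    simpa using this

theorem measurable_eulerSol (f : ℝ → ℝ) (t : ℕ → ℝ) (n : ℕ) : Measurable (eulerSol f t n) := by
  induction n with
  | zero => rw [funext (eulerSol_zero f t)]; exact measurable_const
  | succ n ih => rw [funext (eulerSol_succ f t n)]; fun_prop

/-- Only the last denominator is kept: one power of decay in `x` is all that integrability against
`x ^ (-α)` requires. -/
theorem exists_abs_eulerSol_le (f : ℝ → ℝ) {t : ℕ → ℝ} {n : ℕ} (ht : IsMesh t n) :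
    ∃ D : ℝ, 0 ≤ D ∧ ∀ x : ℝ, 0 ≤ x → |eulerSol f t n x| ≤ D / (1 + stepSize t n * x) := by
  induction n with
  | zero => exact ⟨0, le_rfl, fun x _ => by simp [eulerSol_zero]⟩
  | succ n ih =>
    obtain ⟨D, hD0, hD⟩ := ih ht.of_succ
    have hst := ht.stepSize_pos (Nat.le_add_left 1 n) le_rfl
    refine ⟨D + |stepSize t (n + 1) * f (t (n + 1))|, by positivity, fun x hx => ?_⟩
    -- For `n = 0` truncated subtraction makes `stepSize t 0 = t 0 - t 0 = 0`.
    have hstn : 0 ≤ stepSize t n := by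
      rcases Nat.eq_zero_or_pos n with rfl | hn
      · simp [stepSize]
      · exact (ht.of_succ.stepSize_pos hn le_rfl).le
    rw [eulerSol_succ, abs_div, abs_of_nonneg (by positivity : 0 ≤ 1 + stepSize t (n + 1) * x)]
    gcongr
    refine (abs_add_le _ _).trans (add_le_add_left ((hD x hx).trans (div_le_self hD0 ?_)) _)
    linarith [mul_nonneg hstn hx]

theorem IsSectorial.integrableOn_eulerSol_smul_density {K : ℂ → E} {M α : ℝ}
    (h : IsSectorial K M α) (hα0 : 0 < α) (hα1 : α < 1) (f : ℝ → ℝ) {n : ℕ} {t : ℕ → ℝ}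
    (hn : 1 ≤ n) (ht : IsMesh t n) :
    IntegrableOn (fun x : ℝ => eulerSol f t n x • density K x) (Ioi 0) := by
  obtain ⟨D, hD0, hD⟩ := exists_abs_eulerSol_le f ht
  have hi := (integrableOn_rpow_neg_div_one_add_mul hα0 hα1
    (ht.stepSize_pos hn le_rfl)).const_mul (D * M)
  refine hi.mono' ((measurable_eulerSol f t n).aestronglyMeasurable.smul
    (h.continuousOn_density.aestronglyMeasurable measurableSet_Ioi)) ?_
  refine (ae_restrict_iff' measurableSet_Ioi).2 (Eventually.of_forall fun x hx => ?_)
  have hx0 : 0 < x := hx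
  have hst := ht.stepSize_pos hn le_rfl
  rw [norm_smul, Real.norm_eq_abs]
  calc _ ≤ D / (1 + stepSize t n * x) * (M * x ^ (-α)) :=
        mul_le_mul (hD x hx0.le) (h.norm_density_le hx0) (norm_nonneg _) (by positivity)
    _ = _ := by ring

theorem exists_norm_convolution_sub_gCQ_le {α β M : ℝ} (hα0 : 0 < α) (hα1 : α < 1)
    (hβ : -1 < β) (hM : 0 < M) :
    ∃ C : ℝ, 0 < C ∧ ∀ (n : ℕ) (t : ℕ → ℝ), 1 ≤ n → IsMesh t n →
      ∃ ξ : ℕ → ℝ, (∀ j ∈ Finset.Icc 2 n, ξ j ∈ Ioo (t (j - 1)) (t j)) ∧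
        ∀ (E : Type*) [NormedAddCommGroup E] [NormedSpace ℂ E] [CompleteSpace E]
          (K : ℂ → E) (k : ℝ → E), IsSectorial K M α → IsLaplaceTransform k K →
          ‖convolution k (fun s => s ^ β) (t n) - gCQ K (fun s => s ^ β) t n‖ ≤
            C * (stepSize t 1 ^ (α + β) +
              ∑ j ∈ Finset.Icc 2 n, stepSize t j ^ 2 * ξ j ^ (α + β - 2)) := by
  obtain ⟨C, hC, H⟩ := exists_error_majorant hα0 hα1 hβ
  refine ⟨M * C, by positivity, fun n t hn ht => ?_⟩
  obtain ⟨B, hBi, hB, ξ, hξ, hle⟩ := H n t hn ht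
  refine ⟨ξ, hξ, fun E _ _ _ K k h hk => ?_⟩
  obtain ⟨-, h2, h3⟩ := h.convolution_eq hk hα0 hα1 hβ (ht.pos hn le_rfl)
  rw [h3, gCQ, ← integral_sub h2 (h.integrableOn_eulerSol_smul_density hα0 hα1 _ hn ht)]
  calc _ ≤ ∫ x in Ioi (0 : ℝ), M * B x := by
        refine norm_integral_le_of_norm_le (hBi.const_mul M)
          ((ae_restrict_iff' measurableSet_Ioi).2 (Eventually.of_forall fun x hx => ?_))
        rw [← sub_smul, norm_smul, Real.norm_eq_abs]
        calc _ ≤ |exactSol β x (t n) - eulerSol (fun s => s ^ β) t n x| * (M * x ^ (-α)) := by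
              gcongr; exact h.norm_density_le hx
          _ = M * (x ^ (-α) * |exactSol β x (t n) - eulerSol (fun s => s ^ β) t n x|) := by ring
          _ ≤ _ := by gcongr; exact hB x hx
    _ ≤ M * (C * (stepSize t 1 ^ (α + β) +
          ∑ j ∈ Finset.Icc 2 n, stepSize t j ^ 2 * ξ j ^ (α + β - 2))) := by
        rw [integral_const_mul]; gcongr
    _ = _ := by ring

end GCQ

/-! ### Graded meshes and the sums `∑ j ^ (δ - 2)`. -/

theorem exists_rpow_sub_rpow_sub_one_eq {x : ℝ} (hx : 2 ≤ x) (p : ℝ) :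
    ∃ ξ : ℝ, x / 2 ≤ ξ ∧ ξ ≤ x ∧ x ^ p - (x - 1) ^ p = p * ξ ^ (p - 1) := by
  obtain ⟨ξ, hξ, h⟩ := exists_hasDerivAt_eq_slope (fun y : ℝ => y ^ p)
    (fun y => p * y ^ (p - 1)) (sub_one_lt x)
    (fun y hy => (Real.continuousAt_rpow_const y p
      (Or.inl (by linarith [hy.1]))).continuousWithinAt)
    (fun y hy => Real.hasDerivAt_rpow_const (Or.inl (by linarith [hy.1])))
  refine ⟨ξ, by linarith [hξ.1], hξ.2.le, ?_⟩
  rw [h]; simp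

theorem sum_Icc_two_inv_le {n : ℕ} (hn : 1 ≤ n) :
    1 + ∑ j ∈ Finset.Icc 2 n, ((j : ℝ))⁻¹ ≤ 1 + Real.log n := by
  have h := harmonic_le_one_add_log n
  rw [harmonic_eq_sum_Icc, ← Finset.insert_Icc_add_one_left_eq_Icc hn,
    Finset.sum_insert (by simp)] at h
  push_cast at h
  simpa using h

/-- Each increment of `(δ - 1)⁻¹ j ^ (δ - 1)` equals `ξ ^ (δ - 2)` with `j / 2 ≤ ξ ≤ j`, hence
dominates `j ^ (δ - 2)` up to the factor `2 ^ |δ - 2|`. -/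
theorem one_add_sum_Icc_two_rpow_le {δ : ℝ} (hδ : 1 < δ) {n : ℕ} (hn : 1 ≤ n) :
    1 + ∑ j ∈ Finset.Icc 2 n, (j : ℝ) ^ (δ - 2) ≤
      (1 + 2 ^ |δ - 2| / (δ - 1)) * (n : ℝ) ^ (δ - 1) := by
  have hδ0 : 0 < δ - 1 := sub_pos.2 hδ
  induction n, hn using Nat.le_induction with
  | base =>
    simp only [Finset.Icc_eq_empty_of_lt (show 1 < 2 by norm_num), Finset.sum_empty, add_zero,
      Nat.cast_one, Real.one_rpow, mul_one]
    linarith [show (0 : ℝ) ≤ 2 ^ |δ - 2| / (δ - 1) by positivity]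
  | succ n hn ih =>
    have hx : (2 : ℝ) ≤ ((n + 1 : ℕ) : ℝ) := by exact_mod_cast Nat.succ_le_succ hn
    obtain ⟨ξ, h1, h2, h3⟩ := exists_rpow_sub_rpow_sub_one_eq hx (δ - 1)
    rw [show δ - 1 - 1 = δ - 2 by ring] at h3
    have h4 := (rpow_le_two_rpow_abs_mul (δ - 2) (by linarith) h1 h2).2
    have hξ0 : 0 < ξ := by linarith
    have h5 : ((n + 1 : ℕ) : ℝ) - 1 = n := by push_cast; ring
    rw [h5] at h3
    rw [Finset.sum_Icc_succ_top (by omega), ← add_assoc]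
    calc _ ≤ (1 + 2 ^ |δ - 2| / (δ - 1)) * (n : ℝ) ^ (δ - 1) + 2 ^ |δ - 2| * ξ ^ (δ - 2) :=
          add_le_add ih h4
      _ = (1 + 2 ^ |δ - 2| / (δ - 1)) * (n : ℝ) ^ (δ - 1) +
          2 ^ |δ - 2| / (δ - 1) * ((δ - 1) * ξ ^ (δ - 2)) := by field_simp
      _ ≤ (1 + 2 ^ |δ - 2| / (δ - 1)) * (n : ℝ) ^ (δ - 1) +
          (1 + 2 ^ |δ - 2| / (δ - 1)) * ((δ - 1) * ξ ^ (δ - 2)) := by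
          gcongr; linarith
      _ = _ := by rw [← h3]; ring

namespace GCQ

theorem isMesh_gradedMesh {T γ : ℝ} (hγ : 0 < γ) (hT : 0 < T) {N : ℕ} (hN : 1 ≤ N) (n : ℕ) :
    IsMesh (gradedMesh T γ N) n := by
  have hN0 : (0 : ℝ) < N := by exact_mod_cast hN
  refine ⟨by simp [gradedMesh, hγ.ne'], fun j _ => ?_⟩
  refine Real.rpow_lt_rpow (by positivity) ?_ hγ
  gcongr
  exact_mod_cast Nat.lt_succ_self j

theorem stepSize_sq_mul_rpow_le {γ τ p ξ : ℝ} (hγ : 0 < γ) (hτ : 0 < τ) {t : ℕ → ℝ}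
    (ht : ∀ j : ℕ, t j = (j * τ) ^ γ) {j : ℕ} (hj : 2 ≤ j) (hξ : ξ ∈ Ioo (t (j - 1)) (t j)) :
    stepSize t j ^ 2 * ξ ^ p ≤ (γ * 2 ^ |γ - 1|) ^ 2 * 2 ^ |γ * p| *
      (τ ^ (γ * (p + 2)) * (j : ℝ) ^ (γ * (p + 2) - 2)) := by
  have hj2 : (2 : ℝ) ≤ j := by exact_mod_cast hj
  have hj0 : (0 : ℝ) < j := by linarith
  have hcast : ((j - 1 : ℕ) : ℝ) = j - 1 := by rw [Nat.cast_sub (by omega)]; simp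
  rw [ht, ht, hcast] at hξ
  have hj1 : (0 : ℝ) < (j - 1) * τ := mul_pos (by linarith) hτ
  have hξ0 : 0 < ξ := (Real.rpow_pos_of_pos hj1 _).trans hξ.1
  -- In the ungraded variable `θ` lies between `(j - 1) τ` and `j τ`, and `j ≥ 2` makes it at least
  -- `j τ / 2`; so `ξ` may be replaced by `t_j`.
  obtain ⟨θ, hθ0, rfl⟩ : ∃ θ : ℝ, 0 < θ ∧ θ ^ γ = ξ :=
    ⟨ξ ^ γ⁻¹, by positivity, Real.rpow_inv_rpow hξ0.le hγ.ne'⟩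
  have hθ1 : (j - 1) * τ < θ := (Real.rpow_lt_rpow_iff hj1.le hθ0.le hγ).1 hξ.1
  have hθ2 : θ < j * τ := (Real.rpow_lt_rpow_iff hθ0.le (by positivity) hγ).1 hξ.2
  have hp : (θ ^ γ) ^ p ≤ 2 ^ |γ * p| * (j * τ) ^ (γ * p) := by
    rw [← Real.rpow_mul hθ0.le]
    exact (rpow_le_two_rpow_abs_mul _ (by positivity) (by nlinarith) hθ2.le).1
  have hst : 0 ≤ stepSize t j ∧ stepSize t j ≤ γ * 2 ^ |γ - 1| * (τ ^ γ * (j : ℝ) ^ (γ - 1)) := by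
    obtain ⟨η, h1, h2, h3⟩ := exists_rpow_sub_rpow_sub_one_eq hj2 γ
    have h4 := (rpow_le_two_rpow_abs_mul (γ - 1) hj0 h1 h2).1
    have hη0 : 0 < η := by linarith
    have e : stepSize t j = γ * η ^ (γ - 1) * τ ^ γ := by
      rw [stepSize, ht, ht, hcast, Real.mul_rpow hj0.le hτ.le,
        Real.mul_rpow (by linarith) hτ.le, ← sub_mul, h3]
    rw [e]
    refine ⟨by positivity, ?_⟩
    calc _ ≤ γ * (2 ^ |γ - 1| * (j : ℝ) ^ (γ - 1)) * τ ^ γ := by gcongr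
      _ = _ := by ring
  calc _ ≤ (γ * 2 ^ |γ - 1| * (τ ^ γ * (j : ℝ) ^ (γ - 1))) ^ 2 *
        (2 ^ |γ * p| * (j * τ) ^ (γ * p)) := by
        gcongr
        · exact hst.1
        · exact hst.2
    _ = (γ * 2 ^ |γ - 1|) ^ 2 * 2 ^ |γ * p| * ((τ ^ γ * τ ^ γ * τ ^ (γ * p)) *
        ((j : ℝ) ^ (γ - 1) * (j : ℝ) ^ (γ - 1) * (j : ℝ) ^ (γ * p))) := by
        rw [Real.mul_rpow hj0.le hτ.le]; ring
    _ = _ := by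
        rw [← Real.rpow_add hτ, ← Real.rpow_add hτ, ← Real.rpow_add hj0, ← Real.rpow_add hj0]
        congr 3 <;> ring

theorem exists_gradedMesh_sum_le {γ : ℝ} (hγ : 0 < γ) (q : ℝ) :
    ∃ C : ℝ, 0 < C ∧ ∀ (T : ℝ) (N n : ℕ), 0 < T → 1 ≤ N → ∀ ξ : ℕ → ℝ,
      (∀ j ∈ Finset.Icc 2 n, ξ j ∈ Ioo (gradedMesh T γ N (j - 1)) (gradedMesh T γ N j)) →
      stepSize (gradedMesh T γ N) 1 ^ q +
          ∑ j ∈ Finset.Icc 2 n, stepSize (gradedMesh T γ N) j ^ 2 * ξ j ^ (q - 2) ≤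
        C * ((T ^ (1 / γ) / N) ^ (γ * q) *
          (1 + ∑ j ∈ Finset.Icc 2 n, (j : ℝ) ^ (γ * q - 2))) := by
  set D : ℝ := (γ * 2 ^ |γ - 1|) ^ 2 * 2 ^ |γ * (q - 2)| with hD
  refine ⟨1 + D, by positivity, fun T N n hT hN ξ hξ => ?_⟩
  have hN0 : (0 : ℝ) < N := by exact_mod_cast hN
  set τ : ℝ := T ^ (1 / γ) / N with hτd
  have hτ : 0 < τ := by positivity
  have hsum : ∑ j ∈ Finset.Icc 2 n, stepSize (gradedMesh T γ N) j ^ 2 * ξ j ^ (q - 2) ≤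
      D * (τ ^ (γ * q) * ∑ j ∈ Finset.Icc 2 n, (j : ℝ) ^ (γ * q - 2)) := by
    rw [Finset.mul_sum, Finset.mul_sum]
    refine Finset.sum_le_sum fun j hj => ?_
    have := stepSize_sq_mul_rpow_le (p := q - 2) (t := gradedMesh T γ N) hγ hτ
      (fun _ => rfl) (Finset.mem_Icc.1 hj).1
      (hξ j hj)
    rwa [sub_add_cancel] at this
  have h1 : stepSize (gradedMesh T γ N) 1 ^ q = τ ^ (γ * q) := by
    simp only [stepSize, gradedMesh, ← hτd]
    rw [Real.rpow_mul hτ.le]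
    simp [hγ.ne']
  have hS : 0 ≤ ∑ j ∈ Finset.Icc 2 n, (j : ℝ) ^ (γ * q - 2) :=
    Finset.sum_nonneg fun j _ => by positivity
  rw [h1]
  have hD0 : 0 ≤ D := by positivity
  have hq : 0 ≤ τ ^ (γ * q) := by positivity
  nlinarith [mul_nonneg hD0 hq, mul_nonneg hq hS]

theorem gradedStep_rpow {T γ q : ℝ} (hγ : 0 < γ) (hT : 0 < T) (N : ℕ) :
    (T ^ (1 / γ) / N) ^ (γ * q) = T ^ q * (N : ℝ) ^ (-(γ * q)) := by
  rw [Real.div_rpow (by positivity) (by positivity), ← Real.rpow_mul hT.le,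
    Real.rpow_neg (by positivity), ← mul_assoc, one_div_mul_cancel hγ.ne', one_mul,
    div_eq_mul_inv]

/-- With `τ = T ^ (1 / γ) / N` both sides are `τ (n τ) ^ (γ q - 1)`, since `t_n = (n τ) ^ γ`. -/
theorem gradedMesh_rpow_sub {T γ q : ℝ} (hγ : 0 < γ) (hT : 0 < T) {N n : ℕ} (hN : 1 ≤ N) :
    (T ^ (1 / γ) / N) ^ (γ * q) * (n : ℝ) ^ (γ * q - 1) =
      T ^ (1 / γ) * (N : ℝ)⁻¹ * gradedMesh T γ N n ^ (q - 1 / γ) := by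
  have hN0 : (0 : ℝ) < N := by exact_mod_cast hN
  have hτ : 0 < T ^ (1 / γ) / (N : ℝ) := by positivity
  rw [gradedMesh, ← Real.rpow_mul (by positivity), mul_sub, mul_one_div_cancel hγ.ne',
    Real.mul_rpow (by positivity) hτ.le, Real.rpow_sub_one hτ.ne']
  field_simp

end GCQ

theorem mainTheorem2 (α β M : ℝ) (hα0 : 0 < α) (hα1 : α < 1) (hβ : -1 < β) (hM : 0 < M) :
    (∃ C : ℝ, 0 < C ∧
      ∀ (E : Type*) [NormedAddCommGroup E] [NormedSpace ℂ E] [CompleteSpace E]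
        (K : ℂ → E) (k : ℝ → E), GCQ.IsSectorial K M α → GCQ.IsLaplaceTransform k K →
      ∀ (n : ℕ) (t : ℕ → ℝ), 1 ≤ n → GCQ.IsMesh t n →
        IntervalIntegrable (fun s : ℝ => s ^ β • k (t n - s)) volume 0 (t n) ∧
        IntegrableOn
          (fun x : ℝ => GCQ.eulerSol (fun s => s ^ β) t n x • GCQ.density K x) (Ioi 0) ∧
        ∃ ξ : ℕ → ℝ, (∀ j ∈ Finset.Icc 2 n, ξ j ∈ Ioo (t (j - 1)) (t j)) ∧
          ‖GCQ.convolution k (fun s => s ^ β) (t n) - GCQ.gCQ K (fun s => s ^ β) t n‖ ≤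
            C * (GCQ.stepSize t 1 ^ (α + β) +
              ∑ j ∈ Finset.Icc 2 n, GCQ.stepSize t j ^ 2 * ξ j ^ (α + β - 2))) ∧
    (∀ γ : ℝ, 0 < γ → ∃ C : ℝ, 0 < C ∧
      ∀ (E : Type*) [NormedAddCommGroup E] [NormedSpace ℂ E] [CompleteSpace E]
        (K : ℂ → E) (k : ℝ → E), GCQ.IsSectorial K M α → GCQ.IsLaplaceTransform k K →
      ∀ (T : ℝ) (N n : ℕ), 0 < T → 1 ≤ n → n ≤ N →
        (γ * (α + β) < 1 →
          ‖GCQ.convolution k (fun s => s ^ β) (GCQ.gradedMesh T γ N n) -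
              GCQ.gCQ K (fun s => s ^ β) (GCQ.gradedMesh T γ N) n‖ ≤
            C * T ^ (α + β) * (N : ℝ) ^ (-(γ * (α + β)))) ∧
        (γ * (α + β) = 1 →
          ‖GCQ.convolution k (fun s => s ^ β) (GCQ.gradedMesh T γ N n) -
              GCQ.gCQ K (fun s => s ^ β) (GCQ.gradedMesh T γ N) n‖ ≤
            C * T ^ (α + β) * (N : ℝ)⁻¹ * (1 + Real.log n)) ∧
        (1 < γ * (α + β) →
          ‖GCQ.convolution k (fun s => s ^ β) (GCQ.gradedMesh T γ N n) -
              GCQ.gCQ K (fun s => s ^ β) (GCQ.gradedMesh T γ N) n‖ ≤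
            C * T ^ (1 / γ) * (N : ℝ)⁻¹ *
              GCQ.gradedMesh T γ N n ^ (α + β - 1 / γ))) := by
  refine ⟨?_, fun γ hγ => ?_⟩
  · obtain ⟨C, hC, H⟩ := GCQ.exists_norm_convolution_sub_gCQ_le hα0 hα1 hβ hM
    refine ⟨C, hC, fun E _ _ _ K k hK hk n t hn ht => ?_⟩
    obtain ⟨ξ, hξ, hle⟩ := H n t hn ht
    exact ⟨(hK.convolution_eq hk hα0 hα1 hβ (ht.pos hn le_rfl)).1,
      hK.integrableOn_eulerSol_smul_density hα0 hα1 _ hn ht, ξ, hξ, hle E K k hK hk⟩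
  · obtain ⟨C₁, hC₁, H₁⟩ := GCQ.exists_norm_convolution_sub_gCQ_le hα0 hα1 hβ hM
    obtain ⟨C₂, hC₂, H₂⟩ := GCQ.exists_gradedMesh_sum_le hγ (α + β)
    have H : ∀ (E : Type _) [NormedAddCommGroup E] [NormedSpace ℂ E] [CompleteSpace E]
        (K : ℂ → E) (k : ℝ → E), GCQ.IsSectorial K M α → GCQ.IsLaplaceTransform k K →
        ∀ (T : ℝ) (N n : ℕ), 0 < T → 1 ≤ n → n ≤ N → ∀ S : ℝ,
          1 + ∑ j ∈ Finset.Icc 2 n, (j : ℝ) ^ (γ * (α + β) - 2) ≤ S →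
          ‖GCQ.convolution k (fun s => s ^ β) (GCQ.gradedMesh T γ N n) -
              GCQ.gCQ K (fun s => s ^ β) (GCQ.gradedMesh T γ N) n‖ ≤
            C₁ * C₂ * ((T ^ (1 / γ) / N) ^ (γ * (α + β)) * S) := by
      intro E _ _ _ K k hK hk T N n hT hn hnN S hS
      obtain ⟨ξ, hξ, hle⟩ := H₁ n _ hn (GCQ.isMesh_gradedMesh hγ hT (hn.trans hnN) n)
      refine (hle E K k hK hk).trans ?_
      rw [mul_assoc]
      gcongr
      exact (H₂ T N n hT (hn.trans hnN) ξ hξ).trans (by gcongr)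
    -- As `γ` is fixed before the constant, each regime may choose its own: a convergent series, a
    -- harmonic sum, or growth like `n ^ (δ - 1)`.
    rcases lt_trichotomy (γ * (α + β)) 1 with hδ | hδ | hδ
    · have hs : Summable fun j : ℕ => (j : ℝ) ^ (γ * (α + β) - 2) :=
        Real.summable_nat_rpow.2 (by linarith)
      have hS : 0 ≤ ∑' j : ℕ, (j : ℝ) ^ (γ * (α + β) - 2) := tsum_nonneg fun j => by positivity
      refine ⟨C₁ * C₂ * (1 + ∑' j : ℕ, (j : ℝ) ^ (γ * (α + β) - 2)), by positivity,
        fun E _ _ _ K k hK hk T N n hT hn hnN =>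
          ⟨fun _ => ?_, fun h => absurd h hδ.ne, fun h => absurd h hδ.not_gt⟩⟩
      refine (H E K k hK hk T N n hT hn hnN _ (add_le_add_right
        (hs.sum_le_tsum _ fun j _ => by positivity) 1)).trans (le_of_eq ?_)
      rw [GCQ.gradedStep_rpow hγ hT]; ring
    · refine ⟨C₁ * C₂, by positivity, fun E _ _ _ K k hK hk T N n hT hn hnN =>
        ⟨fun h => absurd hδ h.ne, fun _ => ?_, fun h => absurd hδ h.ne'⟩⟩
      have hsum : ∀ j : ℕ, (j : ℝ) ^ (γ * (α + β) - 2) = (j : ℝ)⁻¹ := fun j => by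
        rw [hδ, ← Real.rpow_neg_one]; norm_num
      refine (H E K k hK hk T N n hT hn hnN (1 + Real.log n) (by
        simp only [hsum]; exact sum_Icc_two_inv_le hn)).trans (le_of_eq ?_)
      rw [GCQ.gradedStep_rpow hγ hT, hδ, Real.rpow_neg_one]; ring
    · have hδ0 : 0 < γ * (α + β) - 1 := sub_pos.2 hδ
      refine ⟨C₁ * C₂ * (1 + 2 ^ |γ * (α + β) - 2| / (γ * (α + β) - 1)), by positivity,
        fun E _ _ _ K k hK hk T N n hT hn hnN =>
          ⟨fun h => absurd hδ h.not_gt, fun h => absurd h hδ.ne', fun _ => ?_⟩⟩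
      refine (H E K k hK hk T N n hT hn hnN _ (one_add_sum_Icc_two_rpow_le hδ hn)).trans
        (le_of_eq ?_)
      linear_combination (C₁ * C₂ * (1 + 2 ^ |γ * (α + β) - 2| / (γ * (α + β) - 1))) *
        GCQ.gradedMesh_rpow_sub (q := α + β) (n := n) hγ hT (hn.trans hnN)
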